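/- Let $K\ge 1$, let $a_0<\dots<a_K$ be real numbers and $I=[a_0,a_K]$. For $k=1,\dots,K$ let $m_k:[a_{k-1},a_k]\to\mathbb R$ be $\mathcal C^1$ and let $\mathbf k_k:[a_{k-1},a_k]^2\to\mathbb R$ be a $\mathcal C^3$ symmetric function that is positive definite in the sense of kernels (all its Gram matrices are positive semidefinite). Derivatives at end points are one-sided. Write \[ {}_k\mathbf M_u=\begin{bmatrix} m_k(u)\\ m_k'(u)\end{bmatrix},\qquad {}_k\mathbf K_{u;v}=\begin{bmatrix}\mathbf k_k(u,v)&\frac{\partial \mathbf k_k}{\partial y}(u,v)\\ \frac{\partial \mathbf k_k}{\partial x}(u,v)&\frac{\partial^2 \mathbf k_k}{\partial x\partial y}(u,v)\end{bmatrix},\qquad {}_k\mathbf K=\begin{bmatrix}{}_k\mathbf K_{a_{k-1};a_{k-1}}&{}_k\mathbf K_{a_{k-1};a_k}\\ {}_k\mathbf K_{a_k;a_{k-1}}&{}_k\mathbf K_{a_k;a_k}\end{bmatrix}. \] Assume that $\mathbf k_k$ is not degenerate at $a_{k-1}$, i.e. $\det {}_k\mathbf K_{a_{k-1};a_{k-1}}\ne0$,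 and not degenerate at $a_k$ given $a_{k-1}$, i.e. $\det {}_k\mathbf K\neq 0$, for every $k$. Definitions. A derivative Gaussian process (DGP) on an interval $J$ with $\mathcal C^1$ mean function $m$ and $\mathcal C^2$ covariance function $\mathbf k$ is an $\mathbb R^2$-valued Gaussian process $(z_t,z_t')_{t\in J}$ with $\mathbb E z_t=m(t)$, $\mathbb E z'_t=m'(t)$, $\mathrm{cov}(z_s,z_t)=\mathbf k(s,t)$, $\mathrm{cov}(z_s,z'_t)=\frac{\partial\mathbf k}{\partial y}(s,t)$, $\mathrm{cov}(z'_s,z'_t)=\frac{\partial^2\mathbf k}{\partial x\partial y}(s,t)$. The $k$-th conditional derivative Gaussian process (CDGP) with end values $x_{k-1},x_k\in\mathbb R^2$ is the DGP with mean and covariance functions \[ m_k(t)+{}_k\tilde{\mathbf K}_t\,{}_k\mathbf K^{-1}\begin{bmatrix}x_{k-1}-{}_k\mathbf M_{a_{k-1}}\\ x_k-{}_k\mathbf M_{a_k}\end{bmatrix},\qquad \mathbf k_k(t,s)-{}_k\tilde{\mathbf K}_t\,{}_k\mathbf K^{-1}\,{}_k\tilde{\mathbf K}_s^T, \] where ${}_k\tilde{\mathbf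 K}_t=\begin{bmatrix}\mathbf k_k(t,a_{k-1})&\frac{\partial\mathbf k_k}{\partial y}(t,a_{k-1})&\mathbf k_k(t,a_k)&\frac{\partial\mathbf k_k}{\partial y}(t,a_k)\end{bmatrix}$. (A) There exists an $\mathbb R^2$-valued stochastic process $(SD_t)_{t\in I}$, $SD_t=(z_t,z'_t)$, such that: 1) $(SD_{a_0},\dots,SD_{a_K})$ has the probability density $p_b(x_0,\dots,x_K)=\prod_{k=0}^K p_{\mathcal N}(x_k;\mu_k^b,\Sigma_k^b)$, where $p_{\mathcal N}(\cdot;\mu,\Sigma)$ is the Gaussian density with mean $\mu$ and covariance matrix $\Sigma$, $\mu_0^b={}_1\mathbf M_{a_0}$, $\Sigma_0^b={}_1\mathbf K_{a_0;a_0}$, and for $k>0$ \[ \mu_k^b={}_k\mathbf M_{a_k}+{}_k\mathbf K_{a_k;a_{k-1}}\,{}_k\mathbf K_{a_{k-1};a_{k-1}}^{-1}(x_{k-1}-{}_k\mathbf M_{a_{k-1}}),\qquad \Sigma_k^b={}_k\mathbf K_{a_k;a_k}-{}_k\mathbf K_{a_k;a_{k-1}}\,{}_k\mathbf K_{a_{k-1};a_{k-1}}^{-1}\,{}_k\mathbf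 K_{a_k;a_{k-1}}^T . \] 2) Conditionally on $(SD_{a_0},\dots,SD_{a_K})=(x_0,\dots,x_K)$ (that is, under a suitable regular conditional distribution of the paths, for every $(x_0,\dots,x_K)$), the restrictions $(SD_t)_{t\in(a_{k-1},a_k)}$, $k=1,\dots,K$, are independent, and the $k$-th one is the $k$-th CDGP with end values $x_{k-1},x_k$. (B) For every process $(SD_t)_{t\in I}=(z_t,z'_t)_{t\in I}$ as in (A), $(z_t)_{t\in I}$ is a Gaussian process, it is $\mathcal C^1$ in the $L^2$ (mean square) sense, and its $L^2$ derivative is $(z'_t)_{t\in I}$. -/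

import Mathlib

open MeasureTheory ProbabilityTheory Set Filter Topology Matrix

noncomputable section

namespace StringGP

/-- `k` is a symmetric positive (semi-)definite function on `I × I`: all its Gram matrices are
symmetric and positive semidefinite. -/
def IsKernelOn (I : Set ℝ) (k : ℝ → ℝ → ℝ) : Prop :=
  ∀ (n : ℕ) (t : Fin n → ℝ), (∀ i, t i ∈ I) →
    (Matrix.of fun i j : Fin n => k (t i) (t j)).PosSemidef

/-- `∂k/∂x (u, v)` for a function `k` on `I × I` (one-sided at end points of `I`). -/
def partialX (I : Set ℝ) (k : ℝ → ℝ → ℝ) (u v : ℝ) : ℝ :=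
  derivWithin (fun x => k x v) I u

/-- `∂k/∂y (u, v)` for a function `k` on `I × I` (one-sided at end points of `I`). -/
def partialY (I : Set ℝ) (k : ℝ → ℝ → ℝ) (u v : ℝ) : ℝ :=
  derivWithin (fun y => k u y) I v

/-- `∂²k/∂x∂y (u, v)` for a function `k` on `I × I`. -/
def partialXY (I : Set ℝ) (k : ℝ → ℝ → ℝ) (u v : ℝ) : ℝ :=
  partialX I (partialY I k) u v

/-- The vector `M_u = (m(u), m'(u))`. -/
def meanVec (I : Set ℝ) (m : ℝ → ℝ) (u : ℝ) : Fin 2 → ℝ :=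
  ![m u, derivWithin m I u]

/-- The matrix `K_{u;v}`. -/
def covBlock (I : Set ℝ) (k : ℝ → ℝ → ℝ) (u v : ℝ) : Matrix (Fin 2) (Fin 2) ℝ :=
  !![k u v, partialY I k u v; partialX I k u v, partialXY I k u v]

/-- The matrix `K_{(a,b);(a,b)}`. -/
def jointBlock (I : Set ℝ) (k : ℝ → ℝ → ℝ) (a b : ℝ) :
    Matrix (Fin 2 ⊕ Fin 2) (Fin 2 ⊕ Fin 2) ℝ :=
  Matrix.fromBlocks (covBlock I k a a) (covBlock I k a b) (covBlock I k b a) (covBlock I k b b)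

/-- The row vector `K̃_{t;(a,b)} = (k(t,a), ∂k/∂y(t,a), k(t,b), ∂k/∂y(t,b))`. -/
def crossRow (I : Set ℝ) (k : ℝ → ℝ → ℝ) (a b t : ℝ) : Fin 2 ⊕ Fin 2 → ℝ :=
  Sum.elim ![k t a, partialY I k t a] ![k t b, partialY I k t b]

/-- `k` is degenerate at `a`: a Gaussian vector `(z_a, z'_a)` with covariance matrix `K_{a;a}`
is degenerate. -/
def DegenerateAt (I : Set ℝ) (k : ℝ → ℝ → ℝ) (a : ℝ) : Prop :=
  (covBlock I k a a).det = 0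

/-- `k` is degenerate at `b` given `a`: the Gaussian vector `(z_a, z'_a)` is not degenerate but
`(z_a, z'_a, z_b, z'_b)` is. -/
def DegenerateAtGiven (I : Set ℝ) (k : ℝ → ℝ → ℝ) (b a : ℝ) : Prop :=
  ¬ DegenerateAt I k a ∧ (jointBlock I k a b).det = 0

section Processes

variable {Ω : Type*} [MeasurableSpace Ω]

/-- `D = (z, z')` is a derivative Gaussian process on `I` with `C¹` mean function `m` and
`C²` covariance function `k`. -/
structure IsDGP (I : Set ℝ) (m : ℝ → ℝ) (k : ℝ → ℝ → ℝ) (D : I → Ω → Fin 2 → ℝ)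
    (P : Measure Ω) : Prop where
  mean_contDiffOn : ContDiffOn ℝ 1 m I
  cov_contDiffOn : ContDiffOn ℝ 2 (fun p : ℝ × ℝ => k p.1 p.2) (I ×ˢ I)
  gaussian : IsGaussianProcess D P
  mean_eq : ∀ (t : I) (i : Fin 2), ∫ ω, D t ω i ∂P = meanVec I m t i
  cov_eq : ∀ (s t : I) (i j : Fin 2),
    cov[fun ω => D s ω i, fun ω => D t ω j; P] = covBlock I k s t i j

/-- Mean function of the DGP on `[a, b]` conditioned to take the values `xa` at `a` and `xb`
at `b`. -/
def condMean (m : ℝ → ℝ) (k : ℝ → ℝ → ℝ) (a b : ℝ) (xa xb : Fin 2 → ℝ) (t : ℝ) : ℝ :=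
  m t + crossRow (Icc a b) k a b t ⬝ᵥ ((jointBlock (Icc a b) k a b)⁻¹ *ᵥ
    Sum.elim (xa - meanVec (Icc a b) m a) (xb - meanVec (Icc a b) m b))

/-- Covariance function of the DGP on `[a, b]` conditioned on its values at `a` and `b`. -/
def condCov (k : ℝ → ℝ → ℝ) (a b : ℝ) (t s : ℝ) : ℝ :=
  k t s - crossRow (Icc a b) k a b t ⬝ᵥ ((jointBlock (Icc a b) k a b)⁻¹ *ᵥ
    crossRow (Icc a b) k a b s)

/-- `D` is (the restriction to the open interval `(a, b)` of) the conditional derivative Gaussian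
process with unconditional mean function `m` and unconditional covariance function `k` on `[a, b]`,
conditioned to take the values `xa` at `a` and `xb` at `b`. -/
def IsCDGP (m : ℝ → ℝ) (k : ℝ → ℝ → ℝ) (a b : ℝ) (xa xb : Fin 2 → ℝ)
    (D : Ioo a b → Ω → Fin 2 → ℝ) (P : Measure Ω) : Prop :=
  IsDGP (Ioo a b) (condMean m k a b xa xb) (condCov k a b) D P

/-- `w` is the mean square (`L²`) derivative of the square integrable process `z` on `I`. -/
structure HasL2Deriv {I : Set ℝ} (z w : I → Ω → ℝ) (P : Measure Ω) : Prop where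
  memLp : ∀ t, MemLp (z t) 2 P
  memLp_deriv : ∀ t, MemLp (w t) 2 P
  tendsto : ∀ t : I, Tendsto
    (fun s : I => eLpNorm (fun ω => (z s ω - z t ω) / ((s : ℝ) - (t : ℝ)) - w t ω) 2 P)
    (𝓝[≠] t) (𝓝 0)

/-- The process `w` is continuous in mean square. -/
def L2Continuous {I : Set ℝ} (w : I → Ω → ℝ) (P : Measure Ω) : Prop :=
  ∀ t : I, Tendsto (fun s : I => eLpNorm (fun ω => w s ω - w t ω) 2 P) (𝓝 t) (𝓝 0)

/-- The process `z` is `C¹` in the `L²` sense. -/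
def IsL2C1 {I : Set ℝ} (z : I → Ω → ℝ) (P : Measure Ω) : Prop :=
  ∃ w : I → Ω → ℝ, HasL2Deriv z w P ∧ L2Continuous w P

end Processes

/-- The density `p_N(x; μ, S)` of the multivariate Gaussian distribution with mean vector `μ` and
(positive definite) covariance matrix `S`. -/
def gaussianDensity {d : ℕ} (x μ : Fin d → ℝ) (S : Matrix (Fin d) (Fin d) ℝ) : ℝ :=
  (Real.sqrt ((2 * Real.pi) ^ d * S.det))⁻¹ *
    Real.exp (-((x - μ) ⬝ᵥ (S⁻¹ *ᵥ (x - μ))) / 2)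

section Strings

variable {K : ℕ}

/-- The closed piece number `j`, with end points `a j.castSucc < a j.succ`. -/
abbrev piece (a : Fin (K + 1) → ℝ) (j : Fin K) : Set ℝ := Icc (a j.castSucc) (a j.succ)

/-- Mean of the boundary value at the right end of piece `j`, given the value `y` at its left
end. -/
def boundaryMean (a : Fin (K + 1) → ℝ) (m : Fin K → ℝ → ℝ) (k : Fin K → ℝ → ℝ → ℝ) (j : Fin K)
    (y : Fin 2 → ℝ) : Fin 2 → ℝ :=
  meanVec (piece a j) (m j) (a j.succ) +
    (covBlock (piece a j) (k j) (a j.succ) (a j.castSucc) *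
      (covBlock (piece a j) (k j) (a j.castSucc) (a j.castSucc))⁻¹) *ᵥ
        (y - meanVec (piece a j) (m j) (a j.castSucc))

/-- Covariance matrix of the boundary value at the right end of piece `j`, given the value at its
left end. -/
def boundaryCov (a : Fin (K + 1) → ℝ) (k : Fin K → ℝ → ℝ → ℝ) (j : Fin K) :
    Matrix (Fin 2) (Fin 2) ℝ :=
  covBlock (piece a j) (k j) (a j.succ) (a j.succ) -
    covBlock (piece a j) (k j) (a j.succ) (a j.castSucc) *
      (covBlock (piece a j) (k j) (a j.castSucc) (a j.castSucc))⁻¹ *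
        (covBlock (piece a j) (k j) (a j.succ) (a j.castSucc))ᵀ

/-- The density `p_b` of the boundary values. -/
def boundaryDensity [NeZero K] (a : Fin (K + 1) → ℝ) (m : Fin K → ℝ → ℝ)
    (k : Fin K → ℝ → ℝ → ℝ) (x : Fin (K + 1) → Fin 2 → ℝ) : ℝ :=
  gaussianDensity (x 0) (meanVec (piece a 0) (m 0) (a 0)) (covBlock (piece a 0) (k 0) (a 0) (a 0)) *
    ∏ j : Fin K, gaussianDensity (x j.succ) (boundaryMean a m k j (x j.castSucc))
      (boundaryCov a k j)

/-- The boundary time `a i` as a point of `[a_0, a_K]`. -/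
def bdryTime {a : Fin (K + 1) → ℝ} (ha : StrictMono a) (i : Fin (K + 1)) :
    Icc (a 0) (a (Fin.last K)) :=
  ⟨a i, ha.monotone (Fin.zero_le i), ha.monotone (Fin.le_last i)⟩

/-- A time in the open piece number `j`, as a point of `[a_0, a_K]`. -/
def innerTime {a : Fin (K + 1) → ℝ} (ha : StrictMono a) (j : Fin K)
    (t : Ioo (a j.castSucc) (a j.succ)) : Icc (a 0) (a (Fin.last K)) :=
  ⟨t, (ha.monotone (Fin.zero_le _)).trans t.2.1.le, t.2.2.le.trans (ha.monotone (Fin.le_last _))⟩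

/-- `SD` is a string derivative Gaussian process on `[a_0, a_K]`: its boundary values have the
density `p_b`, and it has a regular conditional distribution `κ` given the boundary values (a
kernel to the space of paths) such that, for all boundary values `x`, the restrictions of the path
to the open pieces are, under `κ x`, independent conditional derivative Gaussian processes. -/
structure IsStringDGP [NeZero K] {a : Fin (K + 1) → ℝ} (ha : StrictMono a) (m : Fin K → ℝ → ℝ)
    (k : Fin K → ℝ → ℝ → ℝ) {Ω : Type*} [MeasurableSpace Ω]
    (SD : Icc (a 0) (a (Fin.last K)) → Ω → Fin 2 → ℝ) (P : Measure Ω) : Prop where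
  measurable : ∀ t, Measurable (SD t)
  map_boundary : P.map (fun ω i => SD (bdryTime ha i) ω) =
    volume.withDensity fun x => ENNReal.ofReal (boundaryDensity a m k x)
  conditional : ∃ κ : Kernel (Fin (K + 1) → Fin 2 → ℝ) (Icc (a 0) (a (Fin.last K)) → Fin 2 → ℝ),
    IsMarkovKernel κ ∧
    HasCondDistrib (fun ω t => SD t ω) (fun ω i => SD (bdryTime ha i) ω) κ P ∧
    ∀ x : Fin (K + 1) → Fin 2 → ℝ,
      iIndepFun (fun (j : Fin K) (path : Icc (a 0) (a (Fin.last K)) → Fin 2 → ℝ)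
        (t : Ioo (a j.castSucc) (a j.succ)) => path (innerTime ha j t)) (κ x) ∧
      ∀ j : Fin K, IsCDGP (m j) (k j) (a j.castSucc) (a j.succ) (x j.castSucc) (x j.succ)
        (fun t path => path (innerTime ha j t)) (κ x)

end Strings

end StringGP

end

noncomputable section

namespace StringGP

/-! ### Partial and mixed derivatives of a kernel on an interval -/

section KernelCalculus

variable {I : Set ℝ} {k : ℝ → ℝ → ℝ}

/-! Everything rests on one feature of Gaussian conditioning: given the boundary values `x`, the
string has a mean that is affine in `x` and a covariance that does not depend on `x`.

The nondegeneracy hypotheses make each `jointBlock` invertible, hence positive definite, because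
covariance matrices of a process with its derivative are limits of congruences of Gram matrices
(`IsKernelOn.posSemidef_covBlock`). Schur complements then show that `condCov` is again a covariance
and that the noise of the boundary recursion is nondegenerate. Since the conditional covariance is
free of `x`, a single centered process per piece suffices for existence: add the mean determined by
`x`, take the pieces independent, glue them to the boundary values, and let the kernel be the law of
the glued path. The centered process comes from a Hilbert space feature map composed with an
isonormal process (`exists_gaussianProcess`).

For the converse, the boundary vector is a Gaussian autoregression (`isGaussian_chainDensity`). Any
linear combination of values of the string is, given `x`, normal with affine mean and constant
variance, so its law is the convolution of two Gaussian laws (`map_comp_eq_conv`).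

For mean square limits, a conditional second moment is a variance plus a squared mean. The mean is a
deterministic term plus finitely many square integrable functions of `x` with deterministic
coefficients, so `tendsto_eLpNorm_mixture` reduces the problem to deterministic limits. These follow
from the smoothness of `m`, of `crossRow` and of `condCov`. The conditional mean interpolates the
end values and the conditional covariance vanishes at the ends, so the same formulas hold on closed
pieces. At a junction each side is therefore treated alone, and both one-sided derivatives equal the
common boundary value of `z'`. -/

theorem hasDerivWithinAt_partialY (hI : UniqueDiffOn ℝ I)
    (hk : DifferentiableOn ℝ (fun p : ℝ × ℝ => k p.1 p.2) (I ×ˢ I)) {u v : ℝ} (hu : u ∈ I)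
    (hv : v ∈ I) :
    HasDerivWithinAt (fun y => k u y) (partialY I k u v) I v ∧
      partialY I k u v = fderivWithin ℝ (fun p : ℝ × ℝ => k p.1 p.2) (I ×ˢ I) (u, v) (0, 1) := by
  have h1 := (hk (u, v) ⟨hu, hv⟩).hasFDerivWithinAt
  have h2 : HasDerivWithinAt (fun y : ℝ => (u, y)) ((0 : ℝ), (1 : ℝ)) I v :=
    (hasDerivWithinAt_const v I u).prodMk (hasDerivWithinAt_id v I)
  have h3 : HasDerivWithinAt (fun y => k u y)
      (fderivWithin ℝ (fun p : ℝ × ℝ => k p.1 p.2) (I ×ˢ I) (u, v) (0, 1)) I v :=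
    h1.comp_hasDerivWithinAt v h2 (fun y hy => ⟨hu, hy⟩)
  have h4 := h3.derivWithin (hI v hv)
  refine ⟨?_, h4⟩
  have : partialY I k u v = _ := h4
  rwa [this]

theorem hasDerivWithinAt_partialX (hI : UniqueDiffOn ℝ I)
    (hk : DifferentiableOn ℝ (fun p : ℝ × ℝ => k p.1 p.2) (I ×ˢ I)) {u v : ℝ} (hu : u ∈ I)
    (hv : v ∈ I) :
    HasDerivWithinAt (fun x => k x v) (partialX I k u v) I u ∧
      partialX I k u v = fderivWithin ℝ (fun p : ℝ × ℝ => k p.1 p.2) (I ×ˢ I) (u, v) (1, 0) := by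
  have h1 := (hk (u, v) ⟨hu, hv⟩).hasFDerivWithinAt
  have h2 : HasDerivWithinAt (fun x : ℝ => (x, v)) ((1 : ℝ), (0 : ℝ)) I u :=
    (hasDerivWithinAt_id u I).prodMk (hasDerivWithinAt_const u I v)
  have h3 : HasDerivWithinAt (fun x => k x v)
      (fderivWithin ℝ (fun p : ℝ × ℝ => k p.1 p.2) (I ×ˢ I) (u, v) (1, 0)) I u :=
    HasFDerivWithinAt.comp_hasDerivWithinAt (f := fun x : ℝ => (x, v)) u h1 h2
      (fun y hy => ⟨hy, hv⟩)
  have h4 := h3.derivWithin (hI u hu)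
  refine ⟨?_, h4⟩
  have : partialX I k u v = _ := h4
  rwa [this]

/-- On the square the partial derivative is the Fréchet derivative applied to a fixed vector, so
exactly one order of smoothness is lost. -/
theorem contDiffOn_partialY (hI : UniqueDiffOn ℝ I) {n : ℕ}
    (hk : ContDiffOn ℝ (n + 1) (fun p : ℝ × ℝ => k p.1 p.2) (I ×ˢ I)) :
    ContDiffOn ℝ n (fun p : ℝ × ℝ => partialY I k p.1 p.2) (I ×ˢ I) := by
  have h1 : ContDiffOn ℝ n (fderivWithin ℝ (fun p : ℝ × ℝ => k p.1 p.2) (I ×ˢ I)) (I ×ˢ I) :=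
    hk.fderivWithin (hI.prod hI) le_rfl
  refine (h1.clm_apply (contDiffOn_const (c := ((0 : ℝ), (1 : ℝ))))).congr fun p hp => ?_
  exact (hasDerivWithinAt_partialY hI (hk.differentiableOn (by simp)) hp.1 hp.2).2

theorem contDiffOn_partialX (hI : UniqueDiffOn ℝ I) {n : ℕ}
    (hk : ContDiffOn ℝ (n + 1) (fun p : ℝ × ℝ => k p.1 p.2) (I ×ˢ I)) :
    ContDiffOn ℝ n (fun p : ℝ × ℝ => partialX I k p.1 p.2) (I ×ˢ I) := by
  have h1 : ContDiffOn ℝ n (fderivWithin ℝ (fun p : ℝ × ℝ => k p.1 p.2) (I ×ˢ I)) (I ×ˢ I) :=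
    hk.fderivWithin (hI.prod hI) le_rfl
  refine (h1.clm_apply (contDiffOn_const (c := ((1 : ℝ), (0 : ℝ))))).congr fun p hp => ?_
  exact (hasDerivWithinAt_partialX hI (hk.differentiableOn (by simp)) hp.1 hp.2).2

theorem hasDerivWithinAt_partialXY (hI : UniqueDiffOn ℝ I)
    (hk : ContDiffOn ℝ 2 (fun p : ℝ × ℝ => k p.1 p.2) (I ×ˢ I)) {u v : ℝ} (hu : u ∈ I)
    (hv : v ∈ I) :
    HasDerivWithinAt (fun x => partialY I k x v) (partialXY I k u v) I u :=
  (hasDerivWithinAt_partialX hI ((contDiffOn_partialY (n := 1) hI hk).differentiableOn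
    (by simp)) hu hv).1

theorem continuousOn_partialXY (hI : UniqueDiffOn ℝ I)
    (hk : ContDiffOn ℝ 2 (fun p : ℝ × ℝ => k p.1 p.2) (I ×ˢ I)) :
    ContinuousOn (fun p : ℝ × ℝ => partialXY I k p.1 p.2) (I ×ˢ I) :=
  (contDiffOn_partialX (n := 0) hI (contDiffOn_partialY (n := 1) hI hk)).continuousOn

/-- The second difference of a `C²` function of two variables is approximated by its mixed
derivative. -/
theorem exists_second_difference_le (hI : UniqueDiffOn ℝ I) (hc : Convex ℝ I)
    (hk : ContDiffOn ℝ 2 (fun p : ℝ × ℝ => k p.1 p.2) (I ×ˢ I)) {s t : ℝ} (hs : s ∈ I)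
    (ht : t ∈ I) {ε : ℝ} (hε : 0 < ε) :
    ∃ δ > 0, ∀ u ∈ I, ∀ v ∈ I, |u - s| < δ → |v - t| < δ →
      |k u v - k s v - k u t + k s t - partialXY I k s t * ((u - s) * (v - t))| ≤
        ε * (|u - s| * |v - t|) := by
  have hcont := Metric.continuousWithinAt_iff.1 (continuousOn_partialXY hI hk (s, t) ⟨hs, ht⟩) ε hε
  obtain ⟨δ, hδ, hδ'⟩ := hcont
  refine ⟨δ, hδ, fun u hu v hv hus hvt => ?_⟩
  set A := partialXY I k s t with hA
  have hball : ∀ x ∈ I ∩ Metric.ball s δ, ∀ y ∈ I ∩ Metric.ball t δ,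
      ‖partialXY I k x y - A‖ ≤ ε := by
    intro x hx y hy
    have := @hδ' (x, y) ⟨hx.1, hy.1⟩ (by
      rw [Prod.dist_eq]; exact max_lt hx.2 hy.2)
    rw [Real.dist_eq] at this
    exact this.le
  have huI : u ∈ I ∩ Metric.ball s δ := ⟨hu, by rwa [Metric.mem_ball, Real.dist_eq]⟩
  have hvI : v ∈ I ∩ Metric.ball t δ := ⟨hv, by rwa [Metric.mem_ball, Real.dist_eq]⟩
  have hsI : s ∈ I ∩ Metric.ball s δ := ⟨hs, Metric.mem_ball_self hδ⟩
  have htI : t ∈ I ∩ Metric.ball t δ := ⟨ht, Metric.mem_ball_self hδ⟩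
  -- The mean value inequality is used twice: here in the first variable, for `∂k/∂y` minus its
  -- linear part, and then in the second variable, for the increment of `k` itself.
  have hstep : ∀ y ∈ I ∩ Metric.ball t δ,
      ‖partialY I k u y - partialY I k s y - A * (u - s)‖ ≤ ε * |u - s| := by
    intro y hy
    have := Convex.norm_image_sub_le_of_norm_hasDerivWithin_le
      (f := fun x => partialY I k x y - A * x) (f' := fun x => partialXY I k x y - A)
      (s := I ∩ Metric.ball s δ) (C := ε) (x := s) (y := u)
      (fun x hx => by
        have h1 := (hasDerivWithinAt_partialXY hI hk hx.1 hy.1).mono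
          (inter_subset_left (t := Metric.ball s δ))
        have h2 := ((hasDerivWithinAt_id x (I ∩ Metric.ball s δ)).const_mul A)
        exact (h1.fun_sub h2).congr_deriv (by ring))
      (fun x hx => hball x hx y hy) (hc.inter (convex_ball s δ)) hsI huI
    rw [Real.norm_eq_abs (u - s)] at this
    refine le_trans (le_of_eq ?_) this
    congr 1
    ring
  have := Convex.norm_image_sub_le_of_norm_hasDerivWithin_le
      (f := fun y => k u y - k s y - A * (u - s) * y)
      (f' := fun y => partialY I k u y - partialY I k s y - A * (u - s))
      (s := I ∩ Metric.ball t δ) (C := ε * |u - s|) (x := t) (y := v)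
      (fun y hy => by
        have hd := hk.differentiableOn (by simp)
        have h1 := (hasDerivWithinAt_partialY hI hd hu hy.1).1.mono
          (inter_subset_left (t := Metric.ball t δ))
        have h3 := (hasDerivWithinAt_partialY hI hd hs hy.1).1.mono
          (inter_subset_left (t := Metric.ball t δ))
        have h2 := ((hasDerivWithinAt_id y (I ∩ Metric.ball t δ)).const_mul (A * (u - s)))
        exact ((h1.fun_sub h3).fun_sub h2).congr_deriv (by ring))
      hstep (hc.inter (convex_ball t δ)) htI hvI
  rw [Real.norm_eq_abs, Real.norm_eq_abs] at this
  calc _ = |k u v - k s v - A * (u - s) * v - (k u t - k s t - A * (u - s) * t)| := by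
        congr 1; ring
    _ ≤ _ := this
    _ = _ := by ring

/-- Second difference quotients of a `C²` function converge to the mixed derivative. -/
theorem tendsto_second_difference (hI : UniqueDiffOn ℝ I) (hc : Convex ℝ I)
    (hk : ContDiffOn ℝ 2 (fun p : ℝ × ℝ => k p.1 p.2) (I ×ˢ I)) {s t : ℝ} (hs : s ∈ I)
    (ht : t ∈ I) {ι : Type*} {l : Filter ι} {u v : ι → ℝ}
    (hu : Tendsto u l (𝓝[I \ {s}] s)) (hv : Tendsto v l (𝓝[I \ {t}] t)) :
    Tendsto (fun i => (k (u i) (v i) - k s (v i) - k (u i) t + k s t) /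
      ((u i - s) * (v i - t))) l (𝓝 (partialXY I k s t)) := by
  rw [tendsto_nhdsWithin_iff] at hu hv
  rw [Metric.tendsto_nhds]
  intro ε hε
  obtain ⟨δ, hδ, h⟩ := exists_second_difference_le hI hc hk hs ht (half_pos hε)
  filter_upwards [hu.2, hv.2, Metric.tendsto_nhds.1 hu.1 δ hδ, Metric.tendsto_nhds.1 hv.1 δ hδ]
    with i hui hvi hui' hvi'
  rw [Real.dist_eq] at hui' hvi' ⊢
  have h1 := h _ hui.1 _ hvi.1 hui' hvi'
  have hu0 : u i - s ≠ 0 := sub_ne_zero.2 hui.2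
  have hv0 : v i - t ≠ 0 := sub_ne_zero.2 hvi.2
  have hp : 0 < |u i - s| * |v i - t| := by positivity
  calc _ = |k (u i) (v i) - k s (v i) - k (u i) t + k s t -
        partialXY I k s t * ((u i - s) * (v i - t))| / (|u i - s| * |v i - t|) := by
        rw [← abs_mul, ← abs_div]
        congr 1
        field_simp
    _ ≤ ε / 2 := by rwa [div_le_iff₀ hp]
    _ < ε := half_lt_self hε

/-- For a symmetric kernel the second difference quotient is unchanged when the two variables trade
places, so its limits at `(s, t)` and `(t, s)` agree. Unique differentiability makes the punctured
neighbourhoods nontrivial, as uniqueness of limits requires. -/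
theorem partialXY_comm (hI : UniqueDiffOn ℝ I) (hc : Convex ℝ I)
    (hk : ContDiffOn ℝ 2 (fun p : ℝ × ℝ => k p.1 p.2) (I ×ˢ I))
    (hsymm : ∀ x ∈ I, ∀ y ∈ I, k x y = k y x) {s t : ℝ} (hs : s ∈ I) (ht : t ∈ I) :
    partialXY I k s t = partialXY I k t s := by
  have hs' : (𝓝[I \ {s}] s).NeBot := accPt_principal_iff_nhdsWithin.1 (hI s hs).accPt
  have ht' : (𝓝[I \ {t}] t).NeBot := accPt_principal_iff_nhdsWithin.1 (hI t ht).accPt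
  have h1 := tendsto_second_difference hI hc hk hs ht
    (l := 𝓝[I \ {s}] s ×ˢ 𝓝[I \ {t}] t) tendsto_fst tendsto_snd
  have h2 := tendsto_second_difference hI hc hk ht hs
    (l := 𝓝[I \ {s}] s ×ˢ 𝓝[I \ {t}] t) tendsto_snd tendsto_fst
  refine tendsto_nhds_unique h1 (h2.congr' ?_)
  have e1 : ∀ᶠ p in 𝓝[I \ {s}] s ×ˢ 𝓝[I \ {t}] t, p.1 ∈ I \ {s} :=
    tendsto_fst.eventually eventually_mem_nhdsWithin
  have e2 : ∀ᶠ p in 𝓝[I \ {s}] s ×ˢ 𝓝[I \ {t}] t, p.2 ∈ I \ {t} :=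
    tendsto_snd.eventually eventually_mem_nhdsWithin
  filter_upwards [e1, e2] with p hp1 hp2
  rw [hsymm _ hp2.1 _ hp1.1, hsymm _ ht _ hp1.1, hsymm _ hp2.1 _ hs, hsymm _ ht _ hs]
  congr 1 <;> ring

theorem partialX_eq_partialY (hsymm : ∀ x ∈ I, ∀ y ∈ I, k x y = k y x) {s t : ℝ}
    (hs : s ∈ I) (ht : t ∈ I) : partialX I k s t = partialY I k t s :=
  derivWithin_congr (fun x hx => hsymm x hx t ht) (hsymm s hs t ht)

theorem covBlock_transpose (hI : UniqueDiffOn ℝ I) (hc : Convex ℝ I)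
    (hk : ContDiffOn ℝ 2 (fun p : ℝ × ℝ => k p.1 p.2) (I ×ˢ I))
    (hsymm : ∀ x ∈ I, ∀ y ∈ I, k x y = k y x) {s t : ℝ} (hs : s ∈ I) (ht : t ∈ I) :
    (covBlock I k s t)ᵀ = covBlock I k t s := by
  ext i j
  fin_cases i <;> fin_cases j <;>
    simp [covBlock, hsymm s hs t ht, partialX_eq_partialY hsymm hs ht,
      partialX_eq_partialY hsymm ht hs, partialXY_comm hI hc hk hsymm hs ht]

end KernelCalculus

/-! ### Positive semidefiniteness for a process together with its derivative -/

section BlockKernel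

theorem posSemidef_of_tendsto {n : Type*} [Fintype n] {α : Type*} {l : Filter α} [l.NeBot]
    {G : α → Matrix n n ℝ} {A : Matrix n n ℝ} (hG : ∀ a, (G a).PosSemidef)
    (h : ∀ i j, Tendsto (fun a => G a i j) l (𝓝 (A i j))) : A.PosSemidef := by
  refine PosSemidef.of_dotProduct_mulVec_nonneg ?_ fun x => ?_
  · ext i j
    refine tendsto_nhds_unique ?_ (h i j)
    refine (h j i).congr fun a => ?_
    simpa using (hG a).1.apply i j
  · have : Tendsto (fun a => star x ⬝ᵥ (G a *ᵥ x)) l (𝓝 (star x ⬝ᵥ (A *ᵥ x))) := by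
      simp only [dotProduct, mulVec]
      exact tendsto_finsetSum _ fun i _ => tendsto_const_nhds.mul
        (tendsto_finsetSum _ fun j _ => (h i j).mul tendsto_const_nhds)
    exact ge_of_tendsto' this fun a => (hG a).dotProduct_mulVec_nonneg x

variable {I : Set ℝ} {k : ℝ → ℝ → ℝ}

theorem IsKernelOn.posSemidef (hpos : IsKernelOn I k) {ι : Type*} [Fintype ι] (t : ι → ℝ)
    (ht : ∀ i, t i ∈ I) : (Matrix.of fun i j => k (t i) (t j)).PosSemidef := by
  have h := hpos (Fintype.card ι) (fun i => t ((Fintype.equivFin ι).symm i)) (fun i => ht _)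
  convert h.submatrix (Fintype.equivFin ι) using 1
  ext i j
  simp

theorem IsKernelOn.symm (hpos : IsKernelOn I k) : ∀ x ∈ I, ∀ y ∈ I, k x y = k y x := by
  intro x hx y hy
  have := (hpos 2 ![y, x] (by intro i; fin_cases i <;> simpa)).1.apply 0 1
  simpa using this

theorem hasDerivWithinAt_iff_tendsto_div {f : ℝ → ℝ} {f' x : ℝ} {I : Set ℝ} :
    HasDerivWithinAt f f' I x ↔
      Tendsto (fun y => (f y - f x) / (y - x)) (𝓝[I \ {x}] x) (𝓝 f') := by
  rw [hasDerivWithinAt_iff_tendsto_slope]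
  refine tendsto_congr fun y => ?_
  rw [slope_def_field]

/-- The covariance matrices of the process and its derivative are limits of Gram matrices. -/
theorem IsKernelOn.posSemidef_covBlock (hpos : IsKernelOn I k) (hI : UniqueDiffOn ℝ I)
    (hc : Convex ℝ I) (hk : ContDiffOn ℝ 2 (fun p : ℝ × ℝ => k p.1 p.2) (I ×ˢ I))
    {ι : Type*} [Fintype ι] (t : ι → ℝ) (ht : ∀ i, t i ∈ I) :
    (Matrix.of fun a b : ι × Fin 2 => covBlock I k (t a.1) (t b.1) a.2 b.2).PosSemidef := by
  classical
  have hne : ∀ i, (𝓝[I \ {t i}] (t i)).NeBot := fun i =>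
    accPt_principal_iff_nhdsWithin.1 (hI _ (ht i)).accPt
  have hseq : ∀ i, ∃ u : ℕ → ℝ, Tendsto u atTop (𝓝[I \ {t i}] (t i)) ∧ ∀ n, u n ∈ I \ {t i} := by
    intro i
    obtain ⟨u, hu⟩ := exists_seq_tendsto (𝓝[I \ {t i}] (t i))
    obtain ⟨N, hN⟩ := eventually_atTop.1 (hu.eventually eventually_mem_nhdsWithin)
    exact ⟨fun n => u (n + N), hu.comp (tendsto_add_atTop_nat N), fun n => hN _ (by omega)⟩
  choose u hu hmem using hseq
  have hd := hk.differentiableOn (by simp)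
  -- The pair `(z_t, z'_t)` is approximated by `(z_t, (z_u - z_t) / (u - t))`. The columns of `c`
  -- express this pair through `(z_t, z_u)`, and `B` is block diagonal with these blocks, so the
  -- congruence by `B` of the Gram matrix at the points `P n` is the covariance of the
  -- approximations.
  set P : ℕ → ι × Fin 2 → ℝ := fun n a => if a.2 = 0 then t a.1 else u a.1 n with hP
  set c : ℕ → ι → Fin 2 → Fin 2 → ℝ := fun n i => !![1, -(u i n - t i)⁻¹; 0, (u i n - t i)⁻¹]
    with hcdef
  set B : ℕ → Matrix (ι × Fin 2) (ι × Fin 2) ℝ := fun n =>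
    Matrix.of fun a b => if a.1 = b.1 then c n b.1 a.2 b.2 else 0 with hB
  have hG := fun n => (hpos.posSemidef (P n) (fun a => by
    by_cases h : a.2 = 0
    · simp [hP, h, ht]
    · simp [hP, h, (hmem a.1 n).1])).conjTranspose_mul_mul_same (B n)
  have key : ∀ n (a b : ι × Fin 2), ((B n)ᴴ * (Matrix.of fun i j => k (P n i) (P n j)) * B n) a b =
      ∑ q, (∑ p, c n a.1 p a.2 * k (P n (a.1, p)) (P n (b.1, q))) * c n b.1 q b.2 := by
    intro n a b
    simp only [Matrix.mul_apply, hB, conjTranspose_apply, Matrix.of_apply, Fintype.sum_prod_type,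
      star_trivial]
    rw [Finset.sum_comm]
    refine Finset.sum_congr rfl fun q _ => ?_
    simp only [mul_ite, mul_zero, Finset.sum_ite_eq', Finset.mem_univ, if_true]
    congr 1
    rw [Finset.sum_comm]
    refine Finset.sum_congr rfl fun p _ => ?_
    simp [ite_mul]
  refine posSemidef_of_tendsto (l := atTop) hG ?_
  rintro ⟨i, p⟩ ⟨j, q⟩
  refine Tendsto.congr (fun n => (key n (i, p) (j, q)).symm) ?_
  simp only [Fin.sum_univ_two, hP, hcdef]
  fin_cases p <;> fin_cases q
  · simp [covBlock]
  · have := (hasDerivWithinAt_iff_tendsto_div.1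
      (hasDerivWithinAt_partialY hI hd (ht i) (ht j)).1).comp (hu j)
    refine this.congr fun n => ?_
    simp [div_eq_mul_inv]
    ring
  · have := (hasDerivWithinAt_iff_tendsto_div.1
      (hasDerivWithinAt_partialX hI hd (ht i) (ht j)).1).comp (hu i)
    refine this.congr fun n => ?_
    simp [div_eq_mul_inv]
    ring
  · have := tendsto_second_difference hI hc hk (ht i) (ht j) (hu i) (hu j)
    refine this.congr fun n => ?_
    simp [div_eq_mul_inv]
    ring

end BlockKernel

/-! ### Conditional mean and covariance given the end values -/

section Conditioning

/-- The cross covariance matrix of `(z_t, z'_t)` and `(z_a, z'_a, z_b, z'_b)`. -/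
def crossMat (I : Set ℝ) (k : ℝ → ℝ → ℝ) (a b t : ℝ) : Matrix (Fin 2) (Fin 2 ⊕ Fin 2) ℝ :=
  fromCols (covBlock I k t a) (covBlock I k t b)

theorem crossMat_zero (I : Set ℝ) (k : ℝ → ℝ → ℝ) (a b t : ℝ) :
    crossMat I k a b t 0 = crossRow I k a b t := by
  ext (i | i) <;> fin_cases i <;> rfl

variable {a b : ℝ} {k : ℝ → ℝ → ℝ}

/-- Differentiation in `t` carries row 0 of `crossMat` to row 1. Derivatives of `condMean` and
`condCov` are then obtained by replacing rows. -/
theorem hasDerivWithinAt_crossRow (hab : a < b)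
    (hk : ContDiffOn ℝ 2 (fun p : ℝ × ℝ => k p.1 p.2) (Icc a b ×ˢ Icc a b)) {t : ℝ}
    (ht : t ∈ Icc a b) (c : Fin 2 ⊕ Fin 2) :
    HasDerivWithinAt (fun t => crossRow (Icc a b) k a b t c) (crossMat (Icc a b) k a b t 1 c)
      (Icc a b) t := by
  have hI := uniqueDiffOn_Icc hab
  have hd := hk.differentiableOn (by simp)
  have ha := left_mem_Icc.2 hab.le
  have hb := right_mem_Icc.2 hab.le
  rcases c with c | c <;> fin_cases c
  · exact (hasDerivWithinAt_partialX hI hd ht ha).1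
  · exact hasDerivWithinAt_partialXY hI hk ht ha
  · exact (hasDerivWithinAt_partialX hI hd ht hb).1
  · exact hasDerivWithinAt_partialXY hI hk ht hb

/-- Two of the four entries are values of `∂k/∂y`, so a `C³` kernel is what makes the conditional
covariance `C²`. -/
theorem contDiffOn_crossRow (hab : a < b)
    (hk : ContDiffOn ℝ 3 (fun p : ℝ × ℝ => k p.1 p.2) (Icc a b ×ˢ Icc a b))
    (c : Fin 2 ⊕ Fin 2) :
    ContDiffOn ℝ 2 (fun t => crossRow (Icc a b) k a b t c) (Icc a b) := by
  have hY : ContDiffOn ℝ 2 (fun p : ℝ × ℝ => partialY (Icc a b) k p.1 p.2) _ :=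
    contDiffOn_partialY (n := 2) (uniqueDiffOn_Icc hab) hk
  have hk2 : ContDiffOn ℝ 2 (fun p : ℝ × ℝ => k p.1 p.2) _ := hk.of_le (by norm_num)
  have ha := left_mem_Icc.2 hab.le
  have hb := right_mem_Icc.2 hab.le
  have hpair : ∀ y : ℝ, ContDiffOn ℝ 2 (fun t : ℝ => (t, y)) (Icc a b) := fun y =>
    contDiffOn_id.prodMk contDiffOn_const
  rcases c with c | c <;> fin_cases c
  · exact hk2.comp (hpair a) fun t ht => ⟨ht, ha⟩
  · exact hY.comp (hpair a) fun t ht => ⟨ht, ha⟩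
  · exact hk2.comp (hpair b) fun t ht => ⟨ht, hb⟩
  · exact hY.comp (hpair b) fun t ht => ⟨ht, hb⟩

/-- The coefficients of the conditional mean in terms of the boundary values. -/
def condCoef (m : ℝ → ℝ) (k : ℝ → ℝ → ℝ) (a b : ℝ) (xa xb : Fin 2 → ℝ) : Fin 2 ⊕ Fin 2 → ℝ :=
  (jointBlock (Icc a b) k a b)⁻¹ *ᵥ
    Sum.elim (xa - meanVec (Icc a b) m a) (xb - meanVec (Icc a b) m b)

variable {m : ℝ → ℝ}

theorem contDiffOn_condMean (hab : a < b) (hm : ContDiffOn ℝ 1 m (Icc a b))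
    (hk : ContDiffOn ℝ 3 (fun p : ℝ × ℝ => k p.1 p.2) (Icc a b ×ˢ Icc a b))
    (xa xb : Fin 2 → ℝ) : ContDiffOn ℝ 1 (condMean m k a b xa xb) (Icc a b) := by
  refine hm.add ?_
  simp only [dotProduct]
  exact ContDiffOn.sum fun c _ =>
    ((contDiffOn_crossRow hab hk c).of_le (by norm_num)).mul contDiffOn_const

theorem contDiffOn_condCov (hab : a < b)
    (hk : ContDiffOn ℝ 3 (fun p : ℝ × ℝ => k p.1 p.2) (Icc a b ×ˢ Icc a b)) :
    ContDiffOn ℝ 2 (fun p : ℝ × ℝ => condCov k a b p.1 p.2) (Icc a b ×ˢ Icc a b) := by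
  refine (hk.of_le (by norm_num)).sub ?_
  simp only [dotProduct, mulVec]
  have h1 : ∀ c, ContDiffOn ℝ 2 (fun p : ℝ × ℝ => crossRow (Icc a b) k a b p.1 c)
      (Icc a b ×ˢ Icc a b) := fun c =>
    (contDiffOn_crossRow hab hk c).comp contDiffOn_fst fun p hp => hp.1
  have h2 : ∀ c, ContDiffOn ℝ 2 (fun p : ℝ × ℝ => crossRow (Icc a b) k a b p.2 c)
      (Icc a b ×ˢ Icc a b) := fun c =>
    (contDiffOn_crossRow hab hk c).comp contDiffOn_snd fun p hp => hp.2
  exact ContDiffOn.sum fun c _ => (h1 c).mul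
    (ContDiffOn.sum fun d _ => contDiffOn_const.mul (h2 d))

/-- This form isolates the end values in `condCoef`, which does not depend on time. The affine
dependence on `x` and the mean square estimates are both read from it. -/
theorem meanVec_condMean (hab : a < b) (hm : ContDiffOn ℝ 1 m (Icc a b))
    (hk : ContDiffOn ℝ 2 (fun p : ℝ × ℝ => k p.1 p.2) (Icc a b ×ˢ Icc a b))
    (xa xb : Fin 2 → ℝ) {t : ℝ} (ht : t ∈ Icc a b) :
    meanVec (Icc a b) (condMean m k a b xa xb) t =
      meanVec (Icc a b) m t + crossMat (Icc a b) k a b t *ᵥ condCoef m k a b xa xb := by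
  ext i
  fin_cases i
  · exact congrArg (fun r => m t + r ⬝ᵥ condCoef m k a b xa xb) (crossMat_zero _ k a b t).symm
  · have h1 := (hm.differentiableOn (by simp) t ht).hasDerivWithinAt
    have h2 : HasDerivWithinAt (condMean m k a b xa xb)
        (derivWithin m (Icc a b) t + crossMat (Icc a b) k a b t 1 ⬝ᵥ condCoef m k a b xa xb)
        (Icc a b) t := by
      refine h1.add ?_
      simp only [dotProduct]
      exact HasDerivWithinAt.fun_sum fun c _ =>
        (hasDerivWithinAt_crossRow hab hk ht c).mul_const _
    simpa [meanVec, mulVec] using h2.derivWithin (uniqueDiffOn_Icc hab t ht)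

/-- The correction term is bilinear in `crossRow` at `s` and at `t`, so each derivative just
replaces a row 0 of `crossMat` by row 1. The result has the shape of a Schur complement. -/
theorem covBlock_condCov (hab : a < b)
    (hk : ContDiffOn ℝ 2 (fun p : ℝ × ℝ => k p.1 p.2) (Icc a b ×ˢ Icc a b))
    {s t : ℝ} (hs : s ∈ Icc a b) (ht : t ∈ Icc a b) :
    covBlock (Icc a b) (condCov k a b) s t = covBlock (Icc a b) k s t -
      crossMat (Icc a b) k a b s * (jointBlock (Icc a b) k a b)⁻¹ *
        (crossMat (Icc a b) k a b t)ᵀ := by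
  set I := Icc a b with hIdef
  set J := (jointBlock I k a b)⁻¹ with hJ
  have hI : UniqueDiffOn ℝ I := uniqueDiffOn_Icc hab
  have hd := hk.differentiableOn (by simp)
  have hmul : ∀ (v : Fin 2 ⊕ Fin 2 → ℝ) {y : ℝ}, y ∈ I →
      HasDerivWithinAt (fun y => v ⬝ᵥ (J *ᵥ crossRow I k a b y))
        (v ⬝ᵥ (J *ᵥ crossMat I k a b y 1)) I y := by
    intro v y hy
    simp only [dotProduct, mulVec]
    exact HasDerivWithinAt.fun_sum fun c _ => (HasDerivWithinAt.fun_sum fun d _ =>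
      (hasDerivWithinAt_crossRow hab hk hy d).const_mul _).const_mul _
  have hmul' : ∀ (v : Fin 2 ⊕ Fin 2 → ℝ) {y : ℝ}, y ∈ I →
      HasDerivWithinAt (fun y => crossRow I k a b y ⬝ᵥ v) (crossMat I k a b y 1 ⬝ᵥ v) I y := by
    intro v y hy
    simp only [dotProduct]
    exact HasDerivWithinAt.fun_sum fun c _ => (hasDerivWithinAt_crossRow hab hk hy c).mul_const _
  have hY : ∀ {x y : ℝ}, x ∈ I → y ∈ I → partialY I (condCov k a b) x y =
      partialY I k x y - crossRow I k a b x ⬝ᵥ (J *ᵥ crossMat I k a b y 1) := by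
    intro x y hx hy
    exact ((hasDerivWithinAt_partialY hI hd hx hy).1.sub
      (hmul (crossRow I k a b x) hy)).derivWithin (hI y hy)
  have hX : partialX I (condCov k a b) s t =
      partialX I k s t - crossMat I k a b s 1 ⬝ᵥ (J *ᵥ crossRow I k a b t) :=
    ((hasDerivWithinAt_partialX hI hd hs ht).1.sub
      (hmul' (J *ᵥ crossRow I k a b t) hs)).derivWithin (hI s hs)
  have hXY : partialXY I (condCov k a b) s t =
      partialXY I k s t - crossMat I k a b s 1 ⬝ᵥ (J *ᵥ crossMat I k a b t 1) := by
    have h1 : HasDerivWithinAt (fun x => partialY I (condCov k a b) x t)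
        (partialXY I k s t - crossMat I k a b s 1 ⬝ᵥ (J *ᵥ crossMat I k a b t 1)) I s :=
      ((hasDerivWithinAt_partialXY hI hk hs ht).sub
        (hmul' (J *ᵥ crossMat I k a b t 1) hs)).congr (fun x hx => hY hx ht) (hY hs ht)
    exact h1.derivWithin (hI s hs)
  have hentry : ∀ i j, (crossMat I k a b s * J * (crossMat I k a b t)ᵀ) i j =
      crossMat I k a b s i ⬝ᵥ (J *ᵥ crossMat I k a b t j) := by
    intro i j
    rw [Matrix.mul_assoc]
    rfl
  ext i j
  rw [Matrix.sub_apply, hentry]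
  fin_cases i <;> fin_cases j
  · simp [covBlock, crossMat_zero, condCov, ← hIdef, ← hJ]
  · simp [covBlock, crossMat_zero, hY hs ht]
  · simp [covBlock, crossMat_zero, hX]
  · simp [covBlock, hXY]

/-- Conditional processes live on open pieces, while the formulas above use one-sided derivatives on
closed ones. At interior points both are ordinary derivatives. -/
theorem meanVec_Ioo (f : ℝ → ℝ) {t : ℝ} (ht : t ∈ Ioo a b) :
    meanVec (Ioo a b) f t = meanVec (Icc a b) f t := by
  rw [meanVec, meanVec, derivWithin_of_isOpen isOpen_Ioo ht,
    derivWithin_of_mem_nhds (Icc_mem_nhds ht.1 ht.2)]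

theorem covBlock_Ioo (R : ℝ → ℝ → ℝ) {s t : ℝ} (hs : s ∈ Ioo a b) (ht : t ∈ Ioo a b) :
    covBlock (Ioo a b) R s t = covBlock (Icc a b) R s t := by
  have h : ∀ (f : ℝ → ℝ) {u : ℝ}, u ∈ Ioo a b →
      derivWithin f (Ioo a b) u = derivWithin f (Icc a b) u := fun f u hu => by
    rw [derivWithin_of_isOpen isOpen_Ioo hu, derivWithin_of_mem_nhds (Icc_mem_nhds hu.1 hu.2)]
  have hY : ∀ x, partialY (Ioo a b) R x t = partialY (Icc a b) R x t := fun x => h _ ht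
  simp only [covBlock, partialXY, partialX, hY, h _ hs]

/-- At `t = a` the cross covariance consists of the upper rows of `jointBlock` itself, so
multiplication by the inverse leaves the upper rows of the identity. This is why the conditional
process is pinned at its ends. -/
theorem crossMat_left_mul_inv (hJ : (jointBlock (Icc a b) k a b).det ≠ 0) :
    crossMat (Icc a b) k a b a * (jointBlock (Icc a b) k a b)⁻¹ = fromCols 1 0 := by
  have h1 : crossMat (Icc a b) k a b a = (jointBlock (Icc a b) k a b).submatrix Sum.inl id := by
    ext i (j | j) <;> rfl
  have h2 : (fromCols 1 0 : Matrix (Fin 2) (Fin 2 ⊕ Fin 2) ℝ) =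
      (1 : Matrix (Fin 2 ⊕ Fin 2) (Fin 2 ⊕ Fin 2) ℝ).submatrix Sum.inl id := by
    rw [← fromBlocks_one]; ext i (j | j) <;> rfl
  rw [h1, h2, ← Matrix.mul_nonsing_inv _ (isUnit_iff_ne_zero.2 hJ),
    ← Matrix.submatrix_mul_equiv _ _ _ (Equiv.refl _) _]
  simp

theorem crossMat_right_mul_inv (hJ : (jointBlock (Icc a b) k a b).det ≠ 0) :
    crossMat (Icc a b) k a b b * (jointBlock (Icc a b) k a b)⁻¹ = fromCols 0 1 := by
  have h1 : crossMat (Icc a b) k a b b = (jointBlock (Icc a b) k a b).submatrix Sum.inr id := by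
    ext i (j | j) <;> rfl
  have h2 : (fromCols 0 1 : Matrix (Fin 2) (Fin 2 ⊕ Fin 2) ℝ) =
      (1 : Matrix (Fin 2 ⊕ Fin 2) (Fin 2 ⊕ Fin 2) ℝ).submatrix Sum.inr id := by
    rw [← fromBlocks_one]; ext i (j | j) <;> rfl
  rw [h1, h2, ← Matrix.mul_nonsing_inv _ (isUnit_iff_ne_zero.2 hJ),
    ← Matrix.submatrix_mul_equiv _ _ _ (Equiv.refl _) _]
  simp

theorem meanVec_condMean_left (hab : a < b) (hm : ContDiffOn ℝ 1 m (Icc a b))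
    (hk : ContDiffOn ℝ 2 (fun p : ℝ × ℝ => k p.1 p.2) (Icc a b ×ˢ Icc a b))
    (hJ : (jointBlock (Icc a b) k a b).det ≠ 0) (xa xb : Fin 2 → ℝ) :
    meanVec (Icc a b) (condMean m k a b xa xb) a = xa := by
  rw [meanVec_condMean hab hm hk xa xb (left_mem_Icc.2 hab.le), condCoef, mulVec_mulVec,
    crossMat_left_mul_inv hJ, fromCols_mulVec_sumElim]
  simp

theorem meanVec_condMean_right (hab : a < b) (hm : ContDiffOn ℝ 1 m (Icc a b))
    (hk : ContDiffOn ℝ 2 (fun p : ℝ × ℝ => k p.1 p.2) (Icc a b ×ˢ Icc a b))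
    (hJ : (jointBlock (Icc a b) k a b).det ≠ 0) (xa xb : Fin 2 → ℝ) :
    meanVec (Icc a b) (condMean m k a b xa xb) b = xb := by
  rw [meanVec_condMean hab hm hk xa xb (right_mem_Icc.2 hab.le), condCoef, mulVec_mulVec,
    crossMat_right_mul_inv hJ, fromCols_mulVec_sumElim]
  simp

/-- Adjoining `a` and `b` to the list of times makes this a reindexed matrix of
`IsKernelOn.posSemidef_covBlock`. The symmetry of the blocks gives the lower left corner the form
that the Schur complement criterion expects. -/
theorem posSemidef_fromBlocks
    (hab : a < b)
    (hk : ContDiffOn ℝ 3 (fun p : ℝ × ℝ => k p.1 p.2) (Icc a b ×ˢ Icc a b))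
    (hpos : IsKernelOn (Icc a b) k)
    {ι : Type*} [Fintype ι] (t : ι → ℝ) (ht : ∀ i, t i ∈ Icc a b) :
    (fromBlocks (Matrix.of fun p q : ι × Fin 2 => covBlock (Icc a b) k (t p.1) (t q.1) p.2 q.2)
      (Matrix.of fun (p : ι × Fin 2) c => crossMat (Icc a b) k a b (t p.1) p.2 c)
      (Matrix.of fun (p : ι × Fin 2) c => crossMat (Icc a b) k a b (t p.1) p.2 c)ᴴ
      (jointBlock (Icc a b) k a b)).PosSemidef := by
  have hI : UniqueDiffOn ℝ (Icc a b) := uniqueDiffOn_Icc hab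
  have hk2 : ContDiffOn ℝ 2 (fun p : ℝ × ℝ => k p.1 p.2) _ := hk.of_le (by norm_num)
  have ha := left_mem_Icc.2 hab.le
  have hb := right_mem_Icc.2 hab.le
  have h := (hpos.posSemidef_covBlock hI (convex_Icc a b) hk2
    (Sum.elim t ![a, b] : ι ⊕ Fin 2 → ℝ) (by
      rintro (i | i)
      · exact ht i
      · fin_cases i <;> simpa using hab.le)).submatrix
    (Sum.elim (fun p : ι × Fin 2 => ((Sum.inl p.1 : ι ⊕ Fin 2), p.2))
      (Sum.elim (fun i => (Sum.inr 0, i)) (fun i => (Sum.inr 1, i))) :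
        (ι × Fin 2) ⊕ (Fin 2 ⊕ Fin 2) → (ι ⊕ Fin 2) × Fin 2)
  have hT := fun {s t : ℝ} (hs : s ∈ Icc a b) (ht : t ∈ Icc a b) =>
    covBlock_transpose hI (convex_Icc a b) hk2 hpos.symm hs ht
  convert h using 1
  ext (p | p | p) (q | q | q)
  · rfl
  · rfl
  · rfl
  · exact congrFun (congrFun (hT (ht q.1) ha) p) q.2
  · rfl
  · rfl
  · exact congrFun (congrFun (hT (ht q.1) hb) p) q.2
  · rfl
  · rfl

theorem posDef_jointBlock
    (hab : a < b)
    (hk : ContDiffOn ℝ 3 (fun p : ℝ × ℝ => k p.1 p.2) (Icc a b ×ˢ Icc a b))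
    (hpos : IsKernelOn (Icc a b) k)
    (hJ : (jointBlock (Icc a b) k a b).det ≠ 0) :
    (jointBlock (Icc a b) k a b).PosDef := by
  have h := (posSemidef_fromBlocks hab hk hpos (ι := Empty) Empty.elim (fun i => i.elim)).submatrix
    Sum.inr
  exact PosSemidef.posDef_iff_det_ne_zero h |>.2 hJ

theorem posDef_covBlock_left
    (hab : a < b)
    (hk : ContDiffOn ℝ 3 (fun p : ℝ × ℝ => k p.1 p.2) (Icc a b ×ˢ Icc a b))
    (hpos : IsKernelOn (Icc a b) k)
    (hJ : (jointBlock (Icc a b) k a b).det ≠ 0) :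
    (covBlock (Icc a b) k a a).PosDef :=
  (posDef_jointBlock hab hk hpos hJ).submatrix Sum.inl_injective

/-- A Schur complement of a positive semidefinite matrix is positive semidefinite. The factorization
of `det (jointBlock ..)` through it excludes a zero determinant. This matrix is the noise covariance
of the boundary recursion. -/
theorem posDef_schur
    (hab : a < b)
    (hk : ContDiffOn ℝ 3 (fun p : ℝ × ℝ => k p.1 p.2) (Icc a b ×ˢ Icc a b))
    (hpos : IsKernelOn (Icc a b) k)
    (hJ : (jointBlock (Icc a b) k a b).det ≠ 0) :
    (covBlock (Icc a b) k b b - covBlock (Icc a b) k b a * (covBlock (Icc a b) k a a)⁻¹ *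
      (covBlock (Icc a b) k b a)ᵀ).PosDef := by
  have h1 := posDef_jointBlock hab hk hpos hJ
  have h2 := posDef_covBlock_left hab hk hpos hJ
  have hT := covBlock_transpose (uniqueDiffOn_Icc hab) (convex_Icc a b)
    (hk.of_le (by norm_num)) hpos.symm (left_mem_Icc.2 hab.le) (right_mem_Icc.2 hab.le)
  have hT' := covBlock_transpose (uniqueDiffOn_Icc hab) (convex_Icc a b)
    (hk.of_le (by norm_num)) hpos.symm (right_mem_Icc.2 hab.le) (left_mem_Icc.2 hab.le)
  let _ := h2.isUnit.invertible
  have h3 : (covBlock (Icc a b) k b b - (covBlock (Icc a b) k a b)ᴴ *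
      (covBlock (Icc a b) k a a)⁻¹ * covBlock (Icc a b) k a b).PosSemidef := by
    rw [← PosDef.fromBlocks₁₁ _ _ h2, conjTranspose_eq_transpose_of_trivial, hT]
    exact h1.posSemidef
  rw [conjTranspose_eq_transpose_of_trivial, hT] at h3
  rw [hT', PosSemidef.posDef_iff_det_ne_zero h3]
  intro h0
  apply hJ
  rw [jointBlock, det_fromBlocks₁₁, invOf_eq_nonsing_inv, h0, mul_zero]

/-- By `covBlock_condCov`, this is the Schur complement of `jointBlock` in the matrix of
`posSemidef_fromBlocks`. -/
theorem posSemidef_condCov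
    (hab : a < b)
    (hk : ContDiffOn ℝ 3 (fun p : ℝ × ℝ => k p.1 p.2) (Icc a b ×ˢ Icc a b))
    (hpos : IsKernelOn (Icc a b) k)
    (hJ : (jointBlock (Icc a b) k a b).det ≠ 0) {ι : Type*} [Fintype ι]
    (t : ι → ℝ) (ht : ∀ i, t i ∈ Icc a b) :
    (Matrix.of fun p q : ι × Fin 2 =>
      covBlock (Icc a b) (condCov k a b) (t p.1) (t q.1) p.2 q.2).PosSemidef := by
  have h1 := posDef_jointBlock hab hk hpos hJ
  let _ := h1.isUnit.invertible
  have h := (PosDef.fromBlocks₂₂ _ _ h1).1 (posSemidef_fromBlocks hab hk hpos t ht)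
  refine (congrArg PosSemidef (Matrix.ext fun p q => ?_)).mpr h
  simp only [Matrix.of_apply, Matrix.sub_apply]
  rw [covBlock_condCov hab (hk.of_le (by norm_num)) (ht _) (ht _)]
  simp [Matrix.mul_apply]

theorem condCov_symm
    (hab : a < b)
    (hk : ContDiffOn ℝ 3 (fun p : ℝ × ℝ => k p.1 p.2) (Icc a b ×ˢ Icc a b))
    (hpos : IsKernelOn (Icc a b) k)
    (hJ : (jointBlock (Icc a b) k a b).det ≠ 0) :
    ∀ x ∈ Icc a b, ∀ y ∈ Icc a b, condCov k a b x y = condCov k a b y x := by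
  intro x hx y hy
  have h := (posSemidef_condCov hab hk hpos hJ ![x, y]
    (by intro i; fin_cases i <;> simpa)).1.apply (1, 0) (0, 0)
  simpa [covBlock] using h

theorem covBlock_condCov_transpose
    (hab : a < b)
    (hk : ContDiffOn ℝ 3 (fun p : ℝ × ℝ => k p.1 p.2) (Icc a b ×ˢ Icc a b))
    (hpos : IsKernelOn (Icc a b) k)
    (hJ : (jointBlock (Icc a b) k a b).det ≠ 0) {s t : ℝ}
    (hs : s ∈ Icc a b) (ht : t ∈ Icc a b) :
    (covBlock (Icc a b) (condCov k a b) s t)ᵀ = covBlock (Icc a b) (condCov k a b) t s :=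
  covBlock_transpose (uniqueDiffOn_Icc hab) (convex_Icc a b) (contDiffOn_condCov hab hk)
    (condCov_symm hab hk hpos hJ) hs ht

/-- At `s = a` the correction term reproduces the covariance it is subtracted from, so nothing
random is left there. -/
theorem covBlock_condCov_left
    (hab : a < b)
    (hk : ContDiffOn ℝ 3 (fun p : ℝ × ℝ => k p.1 p.2) (Icc a b ×ˢ Icc a b))
    (hpos : IsKernelOn (Icc a b) k)
    (hJ : (jointBlock (Icc a b) k a b).det ≠ 0) {t : ℝ}
    (ht : t ∈ Icc a b) : covBlock (Icc a b) (condCov k a b) a t = 0 := by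
  have hk2 : ContDiffOn ℝ 2 (fun p : ℝ × ℝ => k p.1 p.2) _ := hk.of_le (by norm_num)
  have ha := left_mem_Icc.2 hab.le
  rw [covBlock_condCov hab hk2 ha ht, crossMat_left_mul_inv hJ,
    ← covBlock_transpose (uniqueDiffOn_Icc hab) (convex_Icc a b) hk2 hpos.symm ht ha, crossMat,
    transpose_fromCols, fromCols_mul_fromRows]
  simp

theorem covBlock_condCov_right
    (hab : a < b)
    (hk : ContDiffOn ℝ 3 (fun p : ℝ × ℝ => k p.1 p.2) (Icc a b ×ˢ Icc a b))
    (hpos : IsKernelOn (Icc a b) k)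
    (hJ : (jointBlock (Icc a b) k a b).det ≠ 0) {t : ℝ}
    (ht : t ∈ Icc a b) : covBlock (Icc a b) (condCov k a b) b t = 0 := by
  have hk2 : ContDiffOn ℝ 2 (fun p : ℝ × ℝ => k p.1 p.2) _ := hk.of_le (by norm_num)
  have hb := right_mem_Icc.2 hab.le
  rw [covBlock_condCov hab hk2 hb ht, crossMat_right_mul_inv hJ,
    ← covBlock_transpose (uniqueDiffOn_Icc hab) (convex_Icc a b) hk2 hpos.symm ht hb, crossMat,
    transpose_fromCols, fromCols_mul_fromRows]
  simp

end Conditioning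

/-! ### Gaussian densities and Gaussian autoregressions -/

section GaussianDensity

theorem pi_gaussianReal_eq_withDensity {ι : Type*} [Fintype ι] :
    Measure.pi (fun _ : ι => gaussianReal 0 1) =
      (volume : Measure (ι → ℝ)).withDensity
        fun x => ENNReal.ofReal (∏ i, gaussianPDFReal 0 1 (x i)) := by
  refine (Measure.pi_eq fun s hs => ?_)
  have hint : ∀ i, Integrable ((s i).indicator (gaussianPDFReal 0 1)) :=
    fun i => (integrable_gaussianPDFReal 0 1).indicator (hs i)
  have hnn : ∀ i x, 0 ≤ (s i).indicator (gaussianPDFReal 0 1) x := fun i x =>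
    indicator_nonneg (fun y _ => gaussianPDFReal_nonneg 0 1 y) x
  have h1 : ∀ x : ι → ℝ, ∏ i, (s i).indicator (gaussianPDFReal 0 1) (x i) =
      (univ.pi s).indicator (fun x => ∏ i, gaussianPDFReal 0 1 (x i)) x := by
    intro x
    by_cases hx : x ∈ univ.pi s
    · rw [indicator_of_mem hx]
      exact Finset.prod_congr rfl fun i _ => indicator_of_mem (hx i (mem_univ i)) _
    · rw [indicator_of_notMem hx]
      simp only [Set.mem_pi, mem_univ, true_imp_iff, not_forall] at hx
      obtain ⟨i, hi⟩ := hx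
      exact Finset.prod_eq_zero (Finset.mem_univ i) (indicator_of_notMem hi _)
  rw [withDensity_apply _ (MeasurableSet.univ_pi hs), ← lintegral_indicator
    (MeasurableSet.univ_pi hs)]
  have h2 : ∀ x : ι → ℝ, (univ.pi s).indicator
      (fun x => ENNReal.ofReal (∏ i, gaussianPDFReal 0 1 (x i))) x =
      ENNReal.ofReal (∏ i, (s i).indicator (gaussianPDFReal 0 1) (x i)) := by
    intro x
    rw [h1]
    by_cases hx : x ∈ univ.pi s <;> simp [hx]
  simp_rw [h2]
  have hprod : Integrable (fun x : ι → ℝ => ∏ i, (s i).indicator (gaussianPDFReal 0 1) (x i)) :=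
    Integrable.fintype_prod hint
  rw [← ofReal_integral_eq_lintegral_ofReal hprod
    (Eventually.of_forall fun x => Finset.prod_nonneg fun i _ => hnn i _),
    integral_fintype_prod_volume_eq_prod (fun i => (s i).indicator (gaussianPDFReal 0 1)),
    ENNReal.ofReal_prod_of_nonneg fun i _ => integral_nonneg (hnn i)]
  refine Finset.prod_congr rfl fun i _ => ?_
  rw [integral_indicator (hs i), gaussianReal_apply_eq_integral _ one_ne_zero]

instance isGaussian_pi_gaussianReal {ι : Type*} [Fintype ι] :
    IsGaussian (Measure.pi (fun _ : ι => gaussianReal 0 1)) := by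
  have h := iIndepFun.hasGaussianLaw (X := fun (i : ι) (ω : ι → ℝ) => ω i)
    (P := Measure.pi (fun _ : ι => gaussianReal 0 1))
    (fun i => ⟨by rw [(measurePreserving_eval _ i).map_eq]; infer_instance⟩)
    (iIndepFun_pi (X := fun _ x => x) fun i => aemeasurable_id)
  simpa using h.isGaussian_map

theorem gaussianDensity_sub {d : ℕ} (x μ : Fin d → ℝ) (S : Matrix (Fin d) (Fin d) ℝ) :
    gaussianDensity x μ S = gaussianDensity (x - μ) 0 S := by
  simp [gaussianDensity]

theorem gaussianDensity_nonneg {d : ℕ} (x μ : Fin d → ℝ) (S : Matrix (Fin d) (Fin d) ℝ) :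
    0 ≤ gaussianDensity x μ S := by
  unfold gaussianDensity; positivity

theorem continuous_gaussianDensity {d : ℕ} (S : Matrix (Fin d) (Fin d) ℝ) :
    Continuous fun x : Fin d → ℝ => gaussianDensity x 0 S := by
  unfold gaussianDensity
  fun_prop

/-- The centered Gaussian distribution with density `gaussianDensity · 0 S`. -/
def centeredGaussian {d : ℕ} (S : Matrix (Fin d) (Fin d) ℝ) : Measure (Fin d → ℝ) :=
  volume.withDensity fun x => ENNReal.ofReal (gaussianDensity x 0 S)

/-- Linear change of variables: the Jacobian gives the factor `|det A|⁻¹`, and the quadratic form of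
`S⁻¹` at `x` is the squared Euclidean length of `A⁻¹ x`. The symmetric square root of `S` later
serves as `A`. -/
theorem centeredGaussian_eq_map {d : ℕ} {S A : Matrix (Fin d) (Fin d) ℝ} (hA : A.det ≠ 0)
    (hS : S = A * Aᵀ) :
    centeredGaussian S = (Measure.pi (fun _ : Fin d => gaussianReal 0 1)).map (toLin' A) := by
  have hmeas : Measurable (toLin' A) :=
    (LinearMap.continuous_of_finiteDimensional _).measurable
  have hunit : IsUnit A.det := isUnit_iff_ne_zero.2 hA
  have hG : Measurable fun x : Fin d → ℝ =>
      ENNReal.ofReal (∏ i, gaussianPDFReal 0 1 ((A⁻¹ *ᵥ x) i)) := by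
    have h : Measurable fun x : Fin d → ℝ => A⁻¹ *ᵥ x :=
      (LinearMap.continuous_of_finiteDimensional (Matrix.mulVecLin A⁻¹)).measurable
    exact (Finset.measurable_prod _ fun i _ => (measurable_gaussianPDFReal 0 1).comp
      ((measurable_pi_apply i).comp h)).ennreal_ofReal
  have hdens : ∀ x : Fin d → ℝ, gaussianDensity x 0 S =
      |A.det⁻¹| * ∏ i, gaussianPDFReal 0 1 ((A⁻¹ *ᵥ x) i) := by
    intro x
    have hdet : S.det = A.det ^ 2 := by rw [hS, det_mul, det_transpose, sq]
    have hquad : x ⬝ᵥ (S⁻¹ *ᵥ x) = ∑ i, ((A⁻¹ *ᵥ x) i) ^ 2 := by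
      rw [hS, Matrix.mul_inv_rev, ← transpose_nonsing_inv, ← mulVec_mulVec, dotProduct_mulVec,
        vecMul_transpose, dotProduct]
      simp [sq]
    simp only [gaussianDensity, sub_zero, gaussianPDFReal_def, hdet, hquad, NNReal.coe_one,
      mul_one]
    rw [Finset.prod_mul_distrib, ← Real.exp_sum, Finset.prod_const, Finset.card_univ,
      Fintype.card_fin, Real.sqrt_mul (by positivity), Real.sqrt_sq_eq_abs, mul_inv, abs_inv,
      Real.sqrt_eq_rpow, ← Real.rpow_natCast, ← Real.rpow_mul (by positivity),
      Real.sqrt_eq_rpow, inv_pow, ← Real.rpow_natCast ((2 * Real.pi) ^ (1 / 2 : ℝ)),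
      ← Real.rpow_mul (by positivity), mul_comm (d : ℝ), ← Finset.sum_div]
    rw [Finset.sum_neg_distrib]
    ring
  ext s hs
  rw [Measure.map_apply hmeas hs, pi_gaussianReal_eq_withDensity, centeredGaussian,
    withDensity_apply _ hs, withDensity_apply _ (hmeas hs)]
  have h1 : ∀ x : Fin d → ℝ, ENNReal.ofReal (∏ i, gaussianPDFReal 0 1 (x i)) =
      ENNReal.ofReal (∏ i, gaussianPDFReal 0 1 ((A⁻¹ *ᵥ (toLin' A x)) i)) := by
    intro x
    rw [toLin'_apply, mulVec_mulVec, nonsing_inv_mul _ hunit, one_mulVec]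
  rw [lintegral_congr h1, ← setLIntegral_map hs hG hmeas,
    Real.map_matrix_volume_pi_eq_smul_volume_pi hA,
    Measure.restrict_smul, lintegral_smul_measure, smul_eq_mul, ← lintegral_const_mul _ hG]
  refine lintegral_congr fun x => ?_
  rw [hdens, ENNReal.ofReal_mul (abs_nonneg _)]

open scoped MatrixOrder in
theorem isGaussian_centeredGaussian {d : ℕ} {S : Matrix (Fin d) (Fin d) ℝ} (hS : S.PosDef) :
    IsGaussian (centeredGaussian S) := by
  have h1 := CFC.sqrt_mul_sqrt_self S hS.posSemidef.nonneg
  have h2 : (CFC.sqrt S)ᵀ = CFC.sqrt S := (CFC.sqrt_nonneg S).isSelfAdjoint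
  have h3 : (CFC.sqrt S).det ≠ 0 := by
    intro h
    have := congrArg det h1
    rw [det_mul, h, mul_zero] at this
    exact (isUnit_iff_ne_zero.1 ((isUnit_iff_isUnit_det _).1 hS.isUnit)) this.symm
  rw [centeredGaussian_eq_map h3 (by rw [h2, h1])]
  exact isGaussian_map (LinearMap.toContinuousLinearMap (toLin' (CFC.sqrt S)))

/-- One step of a Gaussian autoregression: the joint law of `(T x + ξ, x)`. -/
theorem isGaussian_withDensity_step {d : ℕ} {S : Matrix (Fin d) (Fin d) ℝ} (hS : S.PosDef)
    {F : Type*} [NormedAddCommGroup F] [NormedSpace ℝ F] [MeasureSpace F] [BorelSpace F]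
    [SecondCountableTopology F] [SFinite (volume : Measure F)] {p : F → ENNReal}
    (hp : Measurable p) (hG : IsGaussian ((volume : Measure F).withDensity p))
    (T : F →L[ℝ] (Fin d → ℝ)) (c : Fin d → ℝ) :
    IsGaussian ((volume : Measure ((Fin d → ℝ) × F)).withDensity fun q =>
      ENNReal.ofReal (gaussianDensity q.1 (T q.2 + c) S) * p q.2) := by
  have := isGaussian_centeredGaussian hS
  set L : (Fin d → ℝ) × F →L[ℝ] (Fin d → ℝ) × F :=
    (ContinuousLinearMap.fst ℝ _ _ + T.comp (ContinuousLinearMap.snd ℝ _ _)).prod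
      (ContinuousLinearMap.snd ℝ _ _) with hL
  have hgm : Measurable fun x : Fin d → ℝ => ENNReal.ofReal (gaussianDensity x 0 S) :=
    (continuous_gaussianDensity S).measurable.ennreal_ofReal
  have hdm : Measurable fun q : (Fin d → ℝ) × F =>
      ENNReal.ofReal (gaussianDensity q.1 (T q.2 + c) S) * p q.2 := by
    refine Measurable.mul ?_ (hp.comp measurable_snd)
    have h : Measurable fun q : (Fin d → ℝ) × F => q.1 - (T q.2 + c) := by fun_prop
    convert! hgm.comp h using 2 with q
    rw [gaussianDensity_sub]
    rfl
  -- The measure is the image of independent noise and state under this affine shear. For a fixed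
  -- state the shear is a translation of the first factor, so translation invariance of Lebesgue
  -- measure identifies the density.
  set Ψ : (Fin d → ℝ) × F → (Fin d → ℝ) × F := fun q => (q.1 + (T q.2 + c), q.2) with hΨ
  have hΨm : Measurable Ψ := by fun_prop
  have hcomp : Ψ = (fun q => q + (c, 0)) ∘ L := by
    funext q
    ext <;> simp [hΨ, hL, add_assoc]
  have key : (volume : Measure ((Fin d → ℝ) × F)).withDensity (fun q =>
      ENNReal.ofReal (gaussianDensity q.1 (T q.2 + c) S) * p q.2) =
      ((centeredGaussian S).prod ((volume : Measure F).withDensity p)).map Ψ := by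
    refine Measure.ext_of_lintegral _ fun f hf => ?_
    have hfΨ : Measurable fun q => f (Ψ q) := hf.comp hΨm
    rw [lintegral_map hf hΨm, lintegral_prod_symm _ hfΨ.aemeasurable,
      lintegral_withDensity_eq_lintegral_mul _ hdm hf, Measure.volume_eq_prod,
      lintegral_prod_symm _ (hdm.mul hf).aemeasurable,
      lintegral_withDensity_eq_lintegral_mul _ hp hfΨ.lintegral_prod_left']
    refine lintegral_congr fun x => ?_
    have hfx : Measurable fun y : Fin d → ℝ => f (Ψ (y, x)) :=
      hfΨ.comp measurable_prodMk_right
    rw [Pi.mul_apply, centeredGaussian, lintegral_withDensity_eq_lintegral_mul _ hgm hfx,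
      ← lintegral_const_mul _ (hgm.mul hfx), ← lintegral_add_right_eq_self _ (T x + c)]
    refine lintegral_congr fun y => ?_
    simp only [Pi.mul_apply, hΨ]
    rw [gaussianDensity_sub _ (T x + c), add_sub_cancel_right]
    ring
  rw [key, hcomp, ← Measure.map_map (by fun_prop) (by fun_prop)]
  infer_instance

/-- The joint density of a Gaussian autoregression. -/
def chainDensity {n d : ℕ} (μ : Fin d → ℝ) (S₀ : Matrix (Fin d) (Fin d) ℝ)
    (f : Fin n → (Fin d → ℝ) → Fin d → ℝ) (S : Fin n → Matrix (Fin d) (Fin d) ℝ)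
    (x : Fin (n + 1) → Fin d → ℝ) : ℝ :=
  gaussianDensity (x 0) μ S₀ * ∏ j, gaussianDensity (x j.succ) (f j (x j.castSucc)) (S j)

/-- Induction on the length: splitting off the last coordinate leaves a shorter chain and one
autoregressive step driven by the last remaining state. -/
theorem isGaussian_chainDensity {d : ℕ} {μ : Fin d → ℝ} {S₀ : Matrix (Fin d) (Fin d) ℝ}
    (hS₀ : S₀.PosDef) (n : ℕ) (A : Fin n → (Fin d → ℝ) →L[ℝ] (Fin d → ℝ))
    (c : Fin n → Fin d → ℝ) (S : Fin n → Matrix (Fin d) (Fin d) ℝ) (hS : ∀ j, (S j).PosDef) :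
    IsGaussian ((volume : Measure (Fin (n + 1) → Fin d → ℝ)).withDensity fun x =>
      ENNReal.ofReal (chainDensity μ S₀ (fun j y => A j y + c j) S x)) := by
  have hcont : ∀ (n : ℕ) (A : Fin n → (Fin d → ℝ) →L[ℝ] (Fin d → ℝ)) (c : Fin n → Fin d → ℝ)
      (S : Fin n → Matrix (Fin d) (Fin d) ℝ),
      Measurable fun x => ENNReal.ofReal (chainDensity μ S₀ (fun j y => A j y + c j) S x) := by
    intro n A c S
    refine (Continuous.measurable ?_).ennreal_ofReal
    have h : chainDensity μ S₀ (fun j y => A j y + c j) S = fun x =>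
        gaussianDensity (x 0 - μ) 0 S₀ * ∏ j, gaussianDensity
          (x j.succ - (A j (x j.castSucc) + c j)) 0 (S j) := by
      funext x
      rw [chainDensity, gaussianDensity_sub]
      exact congrArg _ (Finset.prod_congr rfl fun j _ => gaussianDensity_sub _ _ _)
    rw [h]
    refine ((continuous_gaussianDensity S₀).comp (by fun_prop)).mul
      (continuous_finsetProd _ fun j _ => (continuous_gaussianDensity (S j)).comp (by fun_prop))
  have hpush : ∀ {E : Type} [MeasureSpace E] (n : ℕ)
      (e : E ≃ᵐ (Fin (n + 1) → Fin d → ℝ)) (_ : MeasurePreserving e)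
      (g : (Fin (n + 1) → Fin d → ℝ) → ENNReal) (_ : Measurable g),
      volume.withDensity g = ((volume : Measure E).withDensity (g ∘ e)).map e := by
    intro E _ n e he g hg
    ext s hs
    rw [e.map_apply, withDensity_apply _ hs, withDensity_apply _ (e.measurable hs),
      ← he.setLIntegral_comp_preimage hs hg]
    rfl
  induction n with
  | zero =>
    have h0 := isGaussian_centeredGaussian hS₀
    have he := (volume_preserving_funUnique (Fin 1) (Fin d → ℝ)).symm
    rw [hpush 0 _ he _ (hcont 0 A c S)]
    have h1 : (volume : Measure (Fin d → ℝ)).withDensity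
        ((fun x => ENNReal.ofReal (chainDensity μ S₀ (fun j y => A j y + c j) S x)) ∘
          (MeasurableEquiv.funUnique (Fin 1) (Fin d → ℝ)).symm) =
        (centeredGaussian S₀).map (fun x => x + μ) := by
      refine Measure.ext_of_lintegral _ fun f hf => ?_
      have hgm : Measurable fun x : Fin d → ℝ => ENNReal.ofReal (gaussianDensity x 0 S₀) :=
        (continuous_gaussianDensity S₀).measurable.ennreal_ofReal
      rw [lintegral_map hf (by fun_prop), centeredGaussian,
        lintegral_withDensity_eq_lintegral_mul _
          ((hcont 0 A c S).comp (MeasurableEquiv.measurable _))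
          hf, lintegral_withDensity_eq_lintegral_mul _ hgm (by fun_prop),
        ← lintegral_add_right_eq_self _ μ]
      refine lintegral_congr fun x => ?_
      simp [chainDensity, gaussianDensity_sub _ μ, MeasurableEquiv.funUnique]
    rw [h1]
    exact isGaussian_map (E := Fin d → ℝ) (F := Fin 1 → Fin d → ℝ)
      (ContinuousLinearMap.pi fun _ : Fin 1 => ContinuousLinearMap.id ℝ _)
  | succ n ih =>
    have he := (volume_preserving_piFinSuccAbove (fun _ : Fin (n + 2) => Fin d → ℝ)
      (Fin.last (n + 1))).symm
    rw [hpush (n + 1) _ he _ (hcont (n + 1) A c S)]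
    have h1 := isGaussian_withDensity_step (hS (Fin.last n))
      (hcont n (fun j => A j.castSucc) (fun j => c j.castSucc) (fun j => S j.castSucc))
      (ih (fun j => A j.castSucc) (fun j => c j.castSucc) (fun j => S j.castSucc)
        (fun j => hS _)) ((A (Fin.last n)).comp (ContinuousLinearMap.proj (Fin.last n)))
      (c (Fin.last n))
    have h2 : ∀ q : (Fin d → ℝ) × (Fin (n + 1) → Fin d → ℝ),
        ((fun x => ENNReal.ofReal (chainDensity μ S₀ (fun j y => A j y + c j) S x)) ∘
        (MeasurableEquiv.piFinSuccAbove (fun _ : Fin (n + 2) => Fin d → ℝ)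
          (Fin.last (n + 1))).symm) q = ENNReal.ofReal (gaussianDensity q.1
            (((A (Fin.last n)).comp (ContinuousLinearMap.proj (Fin.last n))) q.2 + c (Fin.last n))
              (S (Fin.last n))) * ENNReal.ofReal (chainDensity μ S₀
                (fun j y => A j.castSucc y + c j.castSucc) (fun j => S j.castSucc) q.2) := by
      rintro ⟨y, x⟩
      rw [← ENNReal.ofReal_mul (gaussianDensity_nonneg _ _ _)]
      refine congrArg ENNReal.ofReal ?_
      have hz : (0 : Fin (n + 2)) = Fin.castSucc 0 := rfl
      simp only [chainDensity, Fin.prod_univ_castSucc, MeasurableEquiv.piFinSuccAbove_symm_apply,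
        Fin.insertNthEquiv, Equiv.coe_fn_mk, Fin.insertNth_last', Fin.succ_last, Fin.snoc_last,
        Fin.succ_castSucc, Fin.snoc_castSucc, hz]
      rw [← mul_assoc, mul_comm (gaussianDensity y _ _)]
      rfl
    rw [funext h2]
    -- Appending the last coordinate is a continuous linear map, and such maps preserve Gaussian
    -- measures.
    have h3 : ⇑(MeasurableEquiv.piFinSuccAbove (fun _ : Fin (n + 2) => Fin d → ℝ)
          (Fin.last (n + 1))).symm =
        ContinuousLinearMap.pi (fun i => Fin.lastCases
          (motive := fun _ => (Fin d → ℝ) × (Fin (n + 1) → Fin d → ℝ) →L[ℝ] (Fin d → ℝ))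
          (ContinuousLinearMap.fst ℝ (Fin d → ℝ)
          (Fin (n + 1) → Fin d → ℝ)) (fun j => (ContinuousLinearMap.proj j).comp
            (ContinuousLinearMap.snd ℝ _ _)) i) := by
      ext q i r
      refine Fin.lastCases ?_ (fun j => ?_) i <;>
        simp [MeasurableEquiv.piFinSuccAbove_symm_apply, Fin.insertNthEquiv, Fin.insertNth_last']
    rw [h3]
    exact isGaussian_map _

end GaussianDensity

/-! ### Construction of Gaussian processes with a given covariance -/

section GaussianProcess

/-- Every linear functional of a finite vector of values is a linear combination of its coordinates,
so one-dimensional laws decide. -/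
theorem isGaussianProcess_of_forall_sum {Ω T : Type*} {mΩ : MeasurableSpace Ω} {P : Measure Ω}
    {X : T → Ω → ℝ} (hX : ∀ t, AEMeasurable (X t) P)
    (h : ∀ (I : Finset T) (c : T → ℝ), IsGaussian (P.map fun ω => ∑ t ∈ I, c t * X t ω)) :
    IsGaussianProcess X P := by
  classical
  refine ⟨fun I => ⟨isGaussian_of_isGaussian_map fun L => ?_⟩⟩
  have hm : AEMeasurable (fun ω => I.restrict (X · ω)) P := by
    rw [aemeasurable_pi_iff]; exact fun i => hX i
  rw [AEMeasurable.map_map_of_aemeasurable (by fun_prop) hm]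
  convert! h I (fun t => if ht : t ∈ I then L (Pi.single ⟨t, ht⟩ 1) else 0) using 2
  ext ω
  rw [Function.comp_apply, ← Finset.sum_attach]
  have := LinearMap.pi_apply_eq_sum_univ (L : (I → ℝ) →ₗ[ℝ] ℝ) (I.restrict (X · ω))
  rw [ContinuousLinearMap.coe_coe] at this
  rw [this, Finset.univ_eq_attach]
  refine Finset.sum_congr rfl fun i _ => ?_
  simp only [Finset.restrict, Finset.coe_mem, dite_true, smul_eq_mul]
  rw [mul_comm]
  congr 2
  ext j
  simp [Pi.single_apply, eq_comm]

theorem IsGaussianProcess.add_const {Ω T E : Type*} {mΩ : MeasurableSpace Ω} {P : Measure Ω}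
    [NormedAddCommGroup E] [NormedSpace ℝ E] [MeasurableSpace E] [BorelSpace E]
    [SecondCountableTopology E]
    {X : T → Ω → E} (hX : IsGaussianProcess X P) (d : T → E) :
    IsGaussianProcess (fun t ω => X t ω + d t) P := by
  refine ⟨fun I => ⟨?_⟩⟩
  have hI := hX.hasGaussianLaw I
  have := hI.isGaussian_map
  have e : (fun ω => I.restrict fun t => X t ω + d t) =
      (fun x : I → E => x + I.restrict d) ∘ fun ω => I.restrict (X · ω) := rfl
  rw [e, ← AEMeasurable.map_map_of_aemeasurable (by fun_prop) hI.aemeasurable]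
  infer_instance

variable {Ω : Type*} {mΩ : MeasurableSpace Ω} {P : Measure Ω}

theorem charFun_map_apply {f : Ω → ℝ} (hf : AEMeasurable f P) (t : ℝ) :
    charFun (P.map f) t = ∫ ω, Complex.exp (t * f ω * Complex.I) ∂P := by
  rw [charFun_apply_real, integral_map hf (by fun_prop)]

/-- The map is Lipschitz with constant `|t|`, since `|exp (i x) - exp (i y)| ≤ |x - y|` and the `L¹`
norm is at most the `L²` norm under a probability measure. It lets Gaussian laws pass to `L²`
limits. -/
theorem continuous_charFun_map_Lp [IsProbabilityMeasure P] (t : ℝ) :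
    Continuous fun f : Lp ℝ 2 P => charFun (P.map f) t := by
  refine (LipschitzWith.of_dist_le_mul (K := ‖t‖₊) fun f g => ?_).continuous
  have hf : Measurable f := (Lp.stronglyMeasurable f).measurable
  have hg : Measurable g := (Lp.stronglyMeasurable g).measurable
  have hint : ∀ {h : Ω → ℝ}, Measurable h →
      Integrable (fun ω => Complex.exp (t * h ω * Complex.I)) P := by
    intro h hh
    refine Integrable.of_bound (by fun_prop) 1 (Eventually.of_forall fun ω => ?_)
    rw [← Complex.ofReal_mul, Complex.norm_exp_ofReal_mul_I]
  have hmem : MemLp (fun ω => f ω - g ω) 2 P := (Lp.memLp f).sub (Lp.memLp g)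
  have hpt : ∀ ω, ‖Complex.exp (t * f ω * Complex.I) - Complex.exp (t * g ω * Complex.I)‖ ≤
      ‖t‖ * ‖f ω - g ω‖ := by
    intro ω
    have h1 : Complex.exp (t * f ω * Complex.I) - Complex.exp (t * g ω * Complex.I) =
        Complex.exp ((t * g ω : ℝ) * Complex.I) *
          (Complex.exp (Complex.I * (t * (f ω - g ω) : ℝ)) - 1) := by
      rw [mul_sub, ← Complex.exp_add, mul_one]
      push_cast
      congr 2
      ring
    rw [h1, norm_mul, Complex.norm_exp_ofReal_mul_I, one_mul, ← norm_mul]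
    exact Real.norm_exp_I_mul_ofReal_sub_one_le
  rw [dist_eq_norm, charFun_map_apply hf.aemeasurable, charFun_map_apply hg.aemeasurable,
    ← integral_sub (hint hf) (hint hg), dist_eq_norm]
  calc _ ≤ ∫ ω, ‖t‖ * ‖f ω - g ω‖ ∂P :=
        norm_integral_le_of_norm_le ((hmem.integrable one_le_two).norm.const_mul _)
          (Eventually.of_forall hpt)
    _ = ‖t‖ * ∫ ω, ‖f ω - g ω‖ ∂P := integral_const_mul _ _
    _ ≤ ‖t‖ * ‖f - g‖ := by
        refine mul_le_mul_of_nonneg_left ?_ (norm_nonneg _)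
        rw [Lp.norm_def, eLpNorm_congr_ae (Lp.coeFn_sub f g),
          integral_norm_eq_lintegral_enorm hmem.1, ← eLpNorm_one_eq_lintegral_enorm]
        exact ENNReal.toReal_mono hmem.2.ne
          (eLpNorm_le_eLpNorm_of_exponent_le one_le_two hmem.1)
    _ = _ := by simp

theorem charFun_map_of_hasGaussianLaw {f : Lp ℝ 2 P} (hf : HasGaussianLaw f P)
    (h0 : ∫ ω, f ω ∂P = 0) (t : ℝ) :
    charFun (P.map f) t = Complex.exp (-(‖f‖ ^ 2 * t ^ 2 / 2 : ℝ)) := by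
  have hv : Var[f; P] = ‖f‖ ^ 2 := by
    rw [variance_eq_integral hf.aemeasurable, h0, ← real_inner_self_eq_norm_sq, L2.inner_def]
    refine integral_congr_ae (Eventually.of_forall fun ω => ?_)
    simp [sq]
  rw [hf.map_eq_gaussianReal, charFun_gaussianReal, h0, hv, Real.coe_toNNReal _ (sq_nonneg _)]
  push_cast
  congr 1
  ring

/-- An isonormal process indexed by a Hilbert space. -/
theorem exists_isonormal (H : Type) [NormedAddCommGroup H] [InnerProductSpace ℝ H]
    [CompleteSpace H] :
    ∃ (Ω : Type) (_ : MeasurableSpace Ω) (P : Measure Ω) (_ : IsProbabilityMeasure P)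
      (W : H →ₗᵢ[ℝ] Lp ℝ 2 P), ∀ h, P.map (W h) = gaussianReal 0 (‖h‖₊ ^ 2) := by
  classical
  obtain ⟨w, b, -⟩ := exists_hilbertBasis ℝ H
  obtain ⟨Ω, mΩ, P, ξ, hξ, hlaw, hind, hP⟩ := exists_iid w (gaussianReal 0 1)
  refine ⟨Ω, mΩ, P, hP, ?_⟩
  have hmem : ∀ i, MemLp (ξ i) 2 P := fun i => by
    have := memLp_id_gaussianReal' (μ := 0) (v := 1) 2 (by simp)
    rw [← (hlaw i).map_eq] at this
    exact this.comp_of_map (hξ i).aemeasurable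
  have hmean : ∀ i, ∫ ω, ξ i ω ∂P = 0 := fun i => by
    rw [(hlaw i).integral_eq, integral_id_gaussianReal]
  have hvar : ∀ i, Var[ξ i; P] = 1 := fun i => by
    rw [(hlaw i).variance_eq, variance_id_gaussianReal]; rfl
  have hgauss : ∀ i, HasGaussianLaw (ξ i) P := fun i => (hlaw i).hasGaussianLaw
  set v : w → Lp ℝ 2 P := fun i => (hmem i).toLp (ξ i) with hv
  have hinner : ∀ i j, inner ℝ (v i) (v j) = cov[ξ i, ξ j; P] := by
    intro i j
    rw [L2.inner_def, covariance_eq_sub (hmem i) (hmem j), hmean i, zero_mul, sub_zero]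
    refine integral_congr_ae ?_
    filter_upwards [(hmem i).coeFn_toLp, (hmem j).coeFn_toLp] with ω h1 h2
    simp only [hv, h1, h2, Pi.mul_apply]
    simp [mul_comm]
  have horth : Orthonormal ℝ v := by
    rw [orthonormal_iff_ite]
    intro i j
    rw [hinner]
    split_ifs with hij
    · rw [hij, covariance_self (hξ j).aemeasurable, hvar]
    · exact (hind.indepFun hij).covariance_eq_zero (hmem i) (hmem j)
  -- The isometry sends a Hilbert basis of `H` to independent standard normal variables, which are
  -- orthonormal in `L²`.
  set W : H →ₗᵢ[ℝ] Lp ℝ 2 P := horth.orthogonalFamily.linearIsometry.comp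
    b.repr.toLinearIsometry with hW
  have hWb : ∀ i, W (b i) = v i := by
    intro i
    simp [hW, b.repr_self, OrthogonalFamily.linearIsometry_apply_single]
  refine ⟨W, fun h => ?_⟩
  have hchar : ∀ t : ℝ, charFun (P.map (W h)) t = Complex.exp (-(‖W h‖ ^ 2 * t ^ 2 / 2 : ℝ)) := by
    intro t
    -- With the variance written as `‖f‖ ^ 2`, both sides are continuous in `f`. It then suffices to
    -- check finite combinations of basis vectors, where independence gives Gaussianity.
    have hclosed : IsClosed {f : Lp ℝ 2 P | charFun (P.map f) t =
        Complex.exp (-(‖f‖ ^ 2 * t ^ 2 / 2 : ℝ))} :=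
      isClosed_eq (continuous_charFun_map_Lp t) (by fun_prop)
    obtain ⟨c, hc⟩ : ∃ c : w → ℝ, HasSum (fun i => c i • b i) h :=
      ⟨fun i => b.repr h i, b.hasSum_repr h⟩
    have hlim : Tendsto (fun s : Finset w => W (∑ i ∈ s, c i • b i)) atTop (𝓝 (W h)) :=
      (W.continuous.tendsto h).comp hc
    refine hclosed.mem_of_tendsto hlim (Eventually.of_forall fun s => ?_)
    have hae : (W (∑ i ∈ s, c i • b i) : Ω → ℝ) =ᵐ[P]
        fun ω => ∑ i : s, c i * ξ i ω := by
      have h1 : W (∑ i ∈ s, c i • b i) = ∑ i : s, c i • v i := by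
        rw [map_sum, ← Finset.sum_coe_sort]
        exact Finset.sum_congr rfl fun i _ => by rw [map_smul, hWb]
      rw [h1]
      refine (Lp.coeFn_finsetSum _ _).trans ?_
      have h2 : ∀ i : s, (⇑(c i • v i) : Ω → ℝ) =ᵐ[P] fun ω => c i * ξ i ω := by
        intro i
        filter_upwards [Lp.coeFn_smul (c i) (v i), (hmem i).coeFn_toLp] with ω h3 h4
        rw [h3, Pi.smul_apply, smul_eq_mul]
        exact congrArg _ h4
      filter_upwards [eventually_all.2 h2] with ω hω
      simp [hω]
    have hgs : HasGaussianLaw (fun ω => ∑ i : s, c i * ξ i ω) P := by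
      have h1 : iIndepFun (fun (i : s) ω => c i * ξ i ω) P :=
        (hind.precomp Subtype.val_injective).comp (fun (i : s) x => c i * x)
          fun i => measurable_const_mul _
      exact h1.hasGaussianLaw_fun_sum fun i => (hgauss i).fun_smul (c i)
    refine charFun_map_of_hasGaussianLaw (hgs.congr hae.symm) ?_ t
    rw [integral_congr_ae hae, integral_finsetSum _ fun (i : s) _ =>
      ((hmem (i : w)).integrable one_le_two).const_mul (c i)]
    exact Finset.sum_eq_zero fun i _ => by rw [integral_const_mul, hmean, mul_zero]
  have : IsProbabilityMeasure (P.map (W h)) :=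
    Measure.isProbabilityMeasure_map (Lp.stronglyMeasurable _).measurable.aemeasurable
  refine Measure.ext_of_charFun (funext fun t => ?_)
  rw [hchar, charFun_gaussianReal, W.norm_map]
  push_cast
  congr 1
  simp

open scoped ComplexOrder in
/-- A positive semidefinite function is the Gram matrix of a family of vectors of a Hilbert
space. -/
theorem exists_feature {T : Type} {C : Matrix T T ℝ} (hC : C.PosSemidef) :
    ∃ (H : Type) (_ : NormedAddCommGroup H) (_ : InnerProductSpace ℝ H) (_ : CompleteSpace H)
      (φ : T → H), ∀ s t, inner ℝ (φ s) (φ t) = C s t := by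
  -- The scalar kernel is read as an operator valued one acting on `ℝ`. The feature of `t` is the
  -- kernel function at `t` applied to `1`, and the reproducing property computes the inner
  -- products.
  set K : Matrix T T (ℝ →L[ℝ] ℝ) := Matrix.of fun s t => C s t • ContinuousLinearMap.id ℝ ℝ
  have hK : K.PosSemidef := by
    refine (List.TFAE.out RKHS.posSemidef_tfae 0 2 rfl rfl).2 ⟨?_, fun (vv : T →₀ ℝ) => ?_⟩
    · ext s t
      have := hC.1.apply s t
      simp only [K, conjTranspose_apply, Matrix.of_apply, star_trivial] at this ⊢
      simp [this, ContinuousLinearMap.star_eq_adjoint, ContinuousLinearMap.adjoint_id]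
    · have := hC.2 vv
      simp only [star_trivial] at this
      refine this.trans_eq ?_
      simp only [RCLike.re_to_real]
      rw [Finsupp.sum_comm]
      refine Finsupp.sum_congr fun s _ => Finsupp.sum_congr fun t _ => ?_
      simp [K]
      ring
  have : Fact K.PosSemidef := ⟨hK⟩
  refine ⟨RKHS.OfKernel K, inferInstance, inferInstance, inferInstance,
    fun t => RKHS.kerFun (RKHS.OfKernel K) t 1, fun s t => ?_⟩
  rw [← RKHS.kernel_inner, RKHS.OfKernel.kernel_ofKernel]
  have := hC.1.apply s t
  simp only [star_trivial] at this
  simp [K, this]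

/-- Existence of centered Gaussian processes with a given covariance function. -/
theorem exists_gaussianProcess {T : Type} {C : Matrix T T ℝ} (hC : C.PosSemidef) :
    ∃ (Ω : Type) (_ : MeasurableSpace Ω) (P : Measure Ω) (_ : IsProbabilityMeasure P)
      (X : T → Ω → ℝ), (∀ t, Measurable (X t)) ∧ IsGaussianProcess X P ∧
        (∀ t, ∫ ω, X t ω ∂P = 0) ∧ ∀ s t, cov[X s, X t; P] = C s t := by
  obtain ⟨H, _, _, _, φ, hφ⟩ := exists_feature hC
  obtain ⟨Ω, mΩ, P, hP, W, hW⟩ := exists_isonormal H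
  have hmeas : ∀ h, Measurable (W h) := fun h => (Lp.stronglyMeasurable _).measurable
  have hmean : ∀ h, ∫ ω, W h ω ∂P = 0 := by
    intro h
    have : HasLaw (W h) (gaussianReal 0 (‖h‖₊ ^ 2)) P := ⟨(hmeas h).aemeasurable, hW h⟩
    rw [this.integral_eq, integral_id_gaussianReal]
  refine ⟨Ω, mΩ, P, hP, fun t => W (φ t), fun t => hmeas _, ?_, fun t => hmean _, fun s t => ?_⟩
  · refine isGaussianProcess_of_forall_sum (fun t => (hmeas _).aemeasurable) fun I c => ?_
    -- By linearity of `W` a combination of values is again a value of the isonormal process, hence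
    -- normal.
    have hae : (fun ω => ∑ t ∈ I, c t * W (φ t) ω) =ᵐ[P] W (∑ t ∈ I, c t • φ t) := by
      rw [map_sum]
      refine EventuallyEq.symm ((Lp.coeFn_finsetSum _ _).trans ?_)
      have h2 : ∀ t, ∀ᵐ ω ∂P, (W (c t • φ t) : Ω → ℝ) ω = c t * W (φ t) ω := by
        intro t
        filter_upwards [Lp.coeFn_smul (c t) (W (φ t))] with ω h3
        rw [map_smul, h3, Pi.smul_apply, smul_eq_mul]
      filter_upwards [(Finset.eventually_all I).2 fun t _ => h2 t] with ω hω
      rw [Finset.sum_apply]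
      exact Finset.sum_congr rfl hω
    rw [Measure.map_congr hae, hW]
    infer_instance
  · rw [covariance_eq_sub (Lp.memLp _) (Lp.memLp _), hmean, zero_mul, sub_zero, ← hφ,
      ← W.inner_map_map, L2.inner_def]
    refine integral_congr_ae (Eventually.of_forall fun ω => ?_)
    simp [mul_comm]

/-- For an infinite index set the quadratic form is tested on finitely supported vectors only, so
each test takes place in a finite submatrix. -/
theorem posSemidef_of_forall_finite {T : Type*} {C : Matrix T T ℝ}
    (h : ∀ s : Finset T, (C.submatrix (fun i : s => (i : T)) (fun i : s => (i : T))).PosSemidef) :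
    C.PosSemidef := by
  classical
  refine ⟨?_, fun x => ?_⟩
  · ext s t
    have := (h {s, t}).1.apply ⟨s, by simp⟩ ⟨t, by simp⟩
    simpa using this
  · have := (h x.support).dotProduct_mulVec_nonneg fun i => x i
    convert! this using 1
    simp only [Finsupp.sum, dotProduct, mulVec, submatrix_apply, Pi.star_apply, Finset.mul_sum,
      mul_assoc]
    rw [← Finset.sum_coe_sort]
    exact Finset.sum_congr rfl fun i _ => (Finset.sum_coe_sort x.support
      (fun j => star (x i) * (C i j * x j))).symm

end GaussianProcess

/-! ### Transport of process properties along a measurable map -/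

section Transfer

variable {Ω Ω' : Type*} {mΩ : MeasurableSpace Ω} {mΩ' : MeasurableSpace Ω'} {P : Measure Ω}
  {f : Ω → Ω'}

theorem isGaussianProcess_map_iff {T E : Type*} [NormedAddCommGroup E] [NormedSpace ℝ E]
    [MeasurableSpace E] [BorelSpace E] {D : T → Ω' → E} (hf : Measurable f)
    (hD : ∀ t, Measurable (D t)) :
    IsGaussianProcess D (P.map f) ↔ IsGaussianProcess (fun t ω => D t (f ω)) P := by
  have h : ∀ I : Finset T, (P.map f).map (fun ω => I.restrict (D · ω)) =
      P.map fun ω => I.restrict fun t => D t (f ω) := fun I =>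
    Measure.map_map (by rw [measurable_pi_iff]; exact fun i => hD i) hf
  exact ⟨fun H => ⟨fun I => ⟨h I ▸ (H.hasGaussianLaw I).isGaussian_map⟩⟩,
    fun H => ⟨fun I => ⟨(h I).symm ▸ (H.hasGaussianLaw I).isGaussian_map⟩⟩⟩

theorem isDGP_map_iff {I : Set ℝ} {m : ℝ → ℝ} {k : ℝ → ℝ → ℝ} {D : I → Ω' → Fin 2 → ℝ}
    (hf : Measurable f) (hD : ∀ t, Measurable (D t)) :
    IsDGP I m k D (P.map f) ↔ IsDGP I m k (fun t ω => D t (f ω)) P := by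
  have h1 : ∀ (t : I) (i : Fin 2), ∫ ω, D t ω i ∂(P.map f) = ∫ ω, D t (f ω) i ∂P := fun t i => by
    have := hD t
    rw [integral_map hf.aemeasurable (by fun_prop)]
  have h2 : ∀ (s t : I) (i j : Fin 2), cov[fun ω => D s ω i, fun ω => D t ω j; P.map f] =
      cov[fun ω => D s (f ω) i, fun ω => D t (f ω) j; P] := fun s t i j => by
    have := hD s
    have := hD t
    rw [covariance_map_fun (by fun_prop) (by fun_prop) hf.aemeasurable]
  have h3 := isGaussianProcess_map_iff (P := P) hf hD
  exact ⟨fun h => ⟨h.1, h.2, h3.1 h.3, fun t i => (h1 t i).symm.trans (h.4 t i),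
      fun s t i j => (h2 s t i j).symm.trans (h.5 s t i j)⟩,
    fun h => ⟨h.1, h.2, h3.2 h.3, fun t i => (h1 t i).trans (h.4 t i),
      fun s t i j => (h2 s t i j).trans (h.5 s t i j)⟩⟩

theorem iIndepFun_map {ι : Type*} {β : ι → Type*} {mβ : ∀ i, MeasurableSpace (β i)}
    {g : ∀ i, Ω' → β i} (hf : Measurable f) (hg : ∀ i, Measurable (g i))
    (h : iIndepFun (fun i ω => g i (f ω)) P) : iIndepFun g (P.map f) := by
  rw [iIndepFun_iff_measure_inter_preimage_eq_mul] at h ⊢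
  intro S sets hsets
  rw [Measure.map_apply hf (Finset.measurableSet_biInter S fun i hi => hg i (hsets i hi)),
    Finset.prod_congr rfl fun i hi => Measure.map_apply hf (hg i (hsets i hi))]
  rw [preimage_iInter₂]
  exact h S hsets

end Transfer

/-! ### The conditional process on one open piece -/

/-- Existence of the centered conditional derivative Gaussian process on an open piece. -/
theorem exists_centered_condDGP {a b : ℝ} {k : ℝ → ℝ → ℝ} (hab : a < b)
    (hk : ContDiffOn ℝ 3 (fun p : ℝ × ℝ => k p.1 p.2) (Icc a b ×ˢ Icc a b))
    (hpos : IsKernelOn (Icc a b) k) (hJ : (jointBlock (Icc a b) k a b).det ≠ 0) :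
    ∃ (Ω : Type) (_ : MeasurableSpace Ω) (P : Measure Ω) (_ : IsProbabilityMeasure P)
      (X : Ioo a b → Ω → Fin 2 → ℝ), (∀ t, Measurable (X t)) ∧
      ∀ m : ℝ → ℝ, ContDiffOn ℝ 1 m (Icc a b) → ∀ xa xb : Fin 2 → ℝ,
        IsCDGP m k a b xa xb
          (fun t ω => X t ω + meanVec (Icc a b) (condMean m k a b xa xb) t) P := by
  -- Times and coordinates together index one real Gaussian process. Only the covariance enters, and
  -- it involves neither `m` nor the end values, so the same `X` serves all of them.
  set C : Matrix (Ioo a b × Fin 2) (Ioo a b × Fin 2) ℝ :=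
    Matrix.of fun p q => covBlock (Icc a b) (condCov k a b) p.1 q.1 p.2 q.2 with hCdef
  have hC : C.PosSemidef := by
    refine posSemidef_of_forall_finite fun s => ?_
    exact (posSemidef_condCov hab hk hpos hJ (fun i : s => ((i : Ioo a b × Fin 2).1 : ℝ))
      fun i => Ioo_subset_Icc_self i.1.1.2).submatrix (fun i : s => (i, (i : Ioo a b × Fin 2).2))
  obtain ⟨Ω, mΩ, P, hP, X, hX, hXg, hX0, hXc⟩ := exists_gaussianProcess hC
  have hint : ∀ p, Integrable (X p) P := fun p => (hXg.hasGaussianLaw_eval p).integrable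
  refine ⟨Ω, mΩ, P, hP, fun t ω i => X (t, i) ω, fun t => ?_, fun m hm xa xb => ?_⟩
  · rw [measurable_pi_iff]; exact fun i => hX _
  · refine ⟨(contDiffOn_condMean hab hm hk xa xb).mono Ioo_subset_Icc_self,
      (contDiffOn_condCov hab hk).mono (prod_mono Ioo_subset_Icc_self Ioo_subset_Icc_self),
      ?_, fun t _ => ?_, fun s t _ _ => ?_⟩
    · refine IsGaussianProcess.add_const ?_
        (fun t : Ioo a b => meanVec (Icc a b) (condMean m k a b xa xb) t)
      classical
      refine hXg.of_isGaussianProcess fun t => ⟨{(t, 0), (t, 1)}, ContinuousLinearMap.pi fun i =>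
        ContinuousLinearMap.proj ⟨(t, i), by fin_cases i <;> simp⟩, fun ω => ?_⟩
      ext i
      rfl
    · simp only [Pi.add_apply]
      rw [integral_add (hint _) (integrable_const _), hX0, meanVec_Ioo _ t.2]
      simp
    · simp only [Pi.add_apply]
      rw [covariance_add_const_left (hint _), covariance_add_const_right (hint _), hXc,
        covBlock_Ioo _ s.2 t.2]
      rfl

/-! ### Boundary and inner times, and the law of the boundary values -/

section Strings

variable {K : ℕ} {a : Fin (K + 1) → ℝ}

theorem bdryTime_injective (ha : StrictMono a) : Function.Injective (bdryTime ha) := fun _ _ h =>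
  ha.injective (congrArg Subtype.val h)

theorem index_eq_of_mem_Ioo (ha : StrictMono a) {i j : Fin K} {t : ℝ}
    (hi : t ∈ Ioo (a i.castSucc) (a i.succ)) (hj : t ∈ Ioo (a j.castSucc) (a j.succ)) : i = j := by
  have h1 := ha.lt_iff_lt.1 (hi.1.trans hj.2)
  have h2 := ha.lt_iff_lt.1 (hj.1.trans hi.2)
  rw [Fin.lt_def] at h1 h2
  simp only [Fin.val_castSucc, Fin.val_succ] at h1 h2
  ext
  omega

theorem bdryTime_ne_innerTime (ha : StrictMono a) (i : Fin (K + 1)) (j : Fin K)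
    (t : Ioo (a j.castSucc) (a j.succ)) : bdryTime ha i ≠ innerTime ha j t := by
  intro h
  have h0 : a i = t := congrArg Subtype.val h
  have h1 := ha.lt_iff_lt.1 (t.2.1.trans_eq h0.symm)
  have h2 := ha.lt_iff_lt.1 (h0.trans_lt t.2.2)
  rw [Fin.lt_def] at h1 h2
  simp only [Fin.val_castSucc, Fin.val_succ] at h1 h2
  omega

theorem exists_mem_piece [NeZero K] {t : ℝ} (ht : t ∈ Icc (a 0) (a (Fin.last K))) :
    ∃ j : Fin K, t ∈ piece a j := by
  have hK : 0 < K := Nat.pos_of_ne_zero (NeZero.ne K)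
  -- Descending from the last node, the search stops at the first one that is at most `t`; the node
  -- `a 0` ends it in any case.
  have H : ∀ n (hn : n < K + 1), 0 < n → t ≤ a ⟨n, hn⟩ → ∃ j : Fin K, t ∈ piece a j := by
    intro n
    induction n with
    | zero => intro _ h; omega
    | succ n ih =>
      intro hn _ hle
      by_cases h : a ⟨n, by omega⟩ ≤ t
      · exact ⟨⟨n, by omega⟩, h, hle⟩
      · rcases Nat.eq_zero_or_pos n with rfl | hpos
        · exact absurd ht.1 h
        · exact ih _ hpos (not_le.1 h).le
  exact H K (by omega) hK ht.2

theorem eq_bdryTime_or_innerTime_of_mem_piece (ha : StrictMono a)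
    {t : Icc (a 0) (a (Fin.last K))} {j : Fin K} (ht : (t : ℝ) ∈ piece a j) :
    t = bdryTime ha j.castSucc ∨ t = bdryTime ha j.succ ∨ ∃ s, t = innerTime ha j s := by
  rcases ht.1.eq_or_lt with h | h
  · exact Or.inl (Subtype.ext h.symm)
  rcases ht.2.eq_or_lt with h' | h'
  · exact Or.inr (Or.inl (Subtype.ext h'))
  · exact Or.inr (Or.inr ⟨⟨t, h, h'⟩, rfl⟩)

theorem eq_bdryTime_or_innerTime [NeZero K] (ha : StrictMono a)
    (t : Icc (a 0) (a (Fin.last K))) :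
    (∃ i, t = bdryTime ha i) ∨ ∃ j s, t = innerTime ha j s := by
  obtain ⟨j, hj⟩ := exists_mem_piece t.2
  rcases eq_bdryTime_or_innerTime_of_mem_piece ha hj with h | h | h
  · exact Or.inl ⟨_, h⟩
  · exact Or.inl ⟨_, h⟩
  · exact Or.inr ⟨j, h⟩

theorem jointBlock_det_ne_zero {k : Fin K → ℝ → ℝ → ℝ} {j : Fin K}
    (hdeg : ¬ DegenerateAt (piece a j) (k j) (a j.castSucc))
    (hdeg' : ¬ DegenerateAtGiven (piece a j) (k j) (a j.succ) (a j.castSucc)) :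
    (jointBlock (piece a j) (k j) (a j.castSucc) (a j.succ)).det ≠ 0 := fun h => hdeg' ⟨hdeg, h⟩

/-- The boundary values form an autoregression with regression matrix `B j` and Schur complement
noise. Expanding `boundaryMean` as a linear part plus a constant puts the density in the form of
`chainDensity`. -/
theorem isGaussian_boundary [NeZero K] (ha : StrictMono a) (m : Fin K → ℝ → ℝ)
    {k : Fin K → ℝ → ℝ → ℝ}
    (hk : ∀ j, ContDiffOn ℝ 3 (fun p : ℝ × ℝ => k j p.1 p.2) (piece a j ×ˢ piece a j))
    (hpos : ∀ j, IsKernelOn (piece a j) (k j))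
    (hJ : ∀ j, (jointBlock (piece a j) (k j) (a j.castSucc) (a j.succ)).det ≠ 0) :
    IsGaussian ((volume : Measure (Fin (K + 1) → Fin 2 → ℝ)).withDensity
      fun x => ENNReal.ofReal (boundaryDensity a m k x)) := by
  have hab : ∀ j : Fin K, a j.castSucc < a j.succ := fun j => ha Fin.castSucc_lt_succ
  set B : Fin K → Matrix (Fin 2) (Fin 2) ℝ := fun j =>
    covBlock (piece a j) (k j) (a j.succ) (a j.castSucc) *
      (covBlock (piece a j) (k j) (a j.castSucc) (a j.castSucc))⁻¹
  have h0 : (covBlock (piece a 0) (k 0) (a 0) (a 0)).PosDef :=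
    posDef_covBlock_left (hab 0) (hk 0) (hpos 0) (hJ 0)
  have := isGaussian_chainDensity (μ := meanVec (piece a 0) (m 0) (a 0)) h0 K
    (fun j => LinearMap.toContinuousLinearMap (Matrix.mulVecLin (B j)))
    (fun j => meanVec (piece a j) (m j) (a j.succ) -
      B j *ᵥ meanVec (piece a j) (m j) (a j.castSucc)) (boundaryCov a k)
    (fun j => posDef_schur (hab j) (hk j) (hpos j) (hJ j))
  convert! this using 4 with x
  refine congrArg₂ _ rfl (Finset.prod_congr rfl fun j _ => ?_)
  congr 1
  simp only [LinearMap.coe_toContinuousLinearMap', Matrix.mulVecLin_apply, boundaryMean,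
    Matrix.mulVec_sub]
  abel

end Strings

/-! ### Gluing the pieces: existence of the string process -/

section Existence

variable {K : ℕ} {a : Fin (K + 1) → ℝ}

theorem measurable_meanVec_condMean {a b : ℝ} {k : ℝ → ℝ → ℝ} {m : ℝ → ℝ} (hab : a < b)
    (hm : ContDiffOn ℝ 1 m (Icc a b))
    (hk : ContDiffOn ℝ 2 (fun p : ℝ × ℝ => k p.1 p.2) (Icc a b ×ˢ Icc a b))
    {t : ℝ} (ht : t ∈ Icc a b) :
    Measurable fun x : (Fin 2 → ℝ) × (Fin 2 → ℝ) =>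
      meanVec (Icc a b) (condMean m k a b x.1 x.2) t := by
  simp_rw [meanVec_condMean hab hm hk _ _ ht, condCoef]
  refine Continuous.measurable (continuous_const.add (Continuous.matrix_mulVec continuous_const
    (Continuous.matrix_mulVec continuous_const ?_)))
  refine continuous_pi fun c => ?_
  rcases c with c | c <;> simp only [Sum.elim_inl, Sum.elim_inr, Pi.sub_apply] <;> fun_prop

open Classical in
/-- The path with boundary values `x` and values `Y j` on the open pieces. -/
def gluePath (ha : StrictMono a) (x : Fin (K + 1) → Fin 2 → ℝ)
    (Y : ∀ j : Fin K, Ioo (a j.castSucc) (a j.succ) → Fin 2 → ℝ)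
    (t : Icc (a 0) (a (Fin.last K))) : Fin 2 → ℝ :=
  if h : ∃ i, t = bdryTime ha i then x h.choose
  else if h : ∃ p : (Σ j : Fin K, Ioo (a j.castSucc) (a j.succ)), t = innerTime ha p.1 p.2 then
    Y h.choose.1 h.choose.2
  -- A default that is never reached, since every time is a boundary time or an inner time.
  else 0

theorem gluePath_bdryTime (ha : StrictMono a) (x : Fin (K + 1) → Fin 2 → ℝ)
    (Y : ∀ j : Fin K, Ioo (a j.castSucc) (a j.succ) → Fin 2 → ℝ) (i : Fin (K + 1)) :
    gluePath ha x Y (bdryTime ha i) = x i := by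
  have h : ∃ i', bdryTime ha i = bdryTime ha i' := ⟨i, rfl⟩
  rw [gluePath, dif_pos h]
  exact congrArg x (bdryTime_injective ha h.choose_spec).symm

theorem gluePath_innerTime (ha : StrictMono a) (x : Fin (K + 1) → Fin 2 → ℝ)
    (Y : ∀ j : Fin K, Ioo (a j.castSucc) (a j.succ) → Fin 2 → ℝ) (j : Fin K)
    (s : Ioo (a j.castSucc) (a j.succ)) :
    gluePath ha x Y (innerTime ha j s) = Y j s := by
  have h1 : ¬ ∃ i, innerTime ha j s = bdryTime ha i := fun ⟨i, hi⟩ =>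
    bdryTime_ne_innerTime ha i j s hi.symm
  have h2 : ∃ p : (Σ j : Fin K, Ioo (a j.castSucc) (a j.succ)),
    innerTime ha j s = innerTime ha p.1 p.2 := ⟨⟨j, s⟩, rfl⟩
  rw [gluePath, dif_neg h1, dif_pos h2]
  -- Open pieces are disjoint, so the chosen index and time are the only possible ones.
  have h3 : h2.choose = ⟨j, s⟩ := by
    have hv : (s : ℝ) = h2.choose.2 := congrArg Subtype.val h2.choose_spec
    generalize h2.choose = p at hv ⊢
    obtain ⟨j', s'⟩ := p
    obtain rfl : j = j' := index_eq_of_mem_Ioo ha s.2 (hv ▸ s'.2)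
    obtain rfl : s = s' := Subtype.ext hv
    rfl
  rw [h3]

theorem measurable_gluePath [NeZero K] {Ω : Type*} [MeasurableSpace Ω] (ha : StrictMono a)
    {x : Ω → Fin (K + 1) → Fin 2 → ℝ}
    {Y : ∀ j : Fin K, Ioo (a j.castSucc) (a j.succ) → Ω → Fin 2 → ℝ} (hx : Measurable x)
    (hY : ∀ j s, Measurable (Y j s)) :
    Measurable fun ω => gluePath ha (x ω) (fun j s => Y j s ω) := by
  rw [measurable_pi_iff]
  intro t
  rcases eq_bdryTime_or_innerTime ha t with ⟨i, rfl⟩ | ⟨j, s, rfl⟩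
  · simp only [gluePath_bdryTime]; fun_prop
  · simp only [gluePath_innerTime]; exact hY j s

theorem exists_isStringDGP [NeZero K] (ha : StrictMono a) {m : Fin K → ℝ → ℝ}
    {k : Fin K → ℝ → ℝ → ℝ}
    (hm : ∀ j, ContDiffOn ℝ 1 (m j) (piece a j))
    (hk : ∀ j, ContDiffOn ℝ 3 (fun p : ℝ × ℝ => k j p.1 p.2) (piece a j ×ˢ piece a j))
    (hpos : ∀ j, IsKernelOn (piece a j) (k j))
    (hJ : ∀ j, (jointBlock (piece a j) (k j) (a j.castSucc) (a j.succ)).det ≠ 0) :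
    ∃ (Ω : Type) (_ : MeasurableSpace Ω) (P : Measure Ω)
        (SD : Icc (a 0) (a (Fin.last K)) → Ω → Fin 2 → ℝ),
      IsProbabilityMeasure P ∧ IsStringDGP ha m k SD P := by
  have hab : ∀ j : Fin K, a j.castSucc < a j.succ := fun j => ha Fin.castSucc_lt_succ
  have hQ := isGaussian_boundary ha m hk hpos hJ
  set Q := (volume : Measure (Fin (K + 1) → Fin 2 → ℝ)).withDensity
    fun x => ENNReal.ofReal (boundaryDensity a m k x) with hQdef
  choose Ω mΩ P hP X hX hC using fun j =>
    exists_centered_condDGP (hab j) (hk j) (hpos j) (hJ j)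
  -- The boundary values enter through the mean alone. The noise on different pieces sits on
  -- different factors of a product space and is independent of the boundary values.
  let Y : ∀ j : Fin K, Ioo (a j.castSucc) (a j.succ) →
      (Fin (K + 1) → Fin 2 → ℝ) × (∀ j, Ω j) → Fin 2 → ℝ := fun j s q =>
    X j s (q.2 j) + meanVec (piece a j)
      (condMean (m j) (k j) (a j.castSucc) (a j.succ) (q.1 j.castSucc) (q.1 j.succ)) s
  have hY : ∀ j s, Measurable (Y j s) := by
    intro j s
    have h1 := hX j s
    have h2 := (measurable_meanVec_condMean (hab j) (hm j) ((hk j).of_le (by norm_num))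
      (Ioo_subset_Icc_self s.2)).comp
      (f := fun q : (Fin (K + 1) → Fin 2 → ℝ) × (∀ j, Ω j) => (q.1 j.castSucc, q.1 j.succ))
      (by fun_prop)
    exact (h1.comp (by fun_prop)).add h2
  set Φ : (Fin (K + 1) → Fin 2 → ℝ) × (∀ j, Ω j) → Icc (a 0) (a (Fin.last K)) → Fin 2 → ℝ :=
    fun q => gluePath ha q.1 (fun j s => Y j s q) with hΦdef
  have hΦ : Measurable Φ := measurable_gluePath ha measurable_fst hY
  set ν := Measure.pi P with hν
  -- The law of the glued path with `x` frozen. Defining it as an image of the kernel `x ↦ δ_x ⊗ ν`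
  -- makes measurability in `x` automatic.
  set κ : Kernel (Fin (K + 1) → Fin 2 → ℝ) (Icc (a 0) (a (Fin.last K)) → Fin 2 → ℝ) :=
    (Kernel.id ×ₖ Kernel.const _ ν).map Φ with hκdef
  have hκ : ∀ x, κ x = ν.map fun ω => Φ (x, ω) := by
    intro x
    rw [hκdef, Kernel.map_apply _ hΦ, Kernel.prod_apply, Kernel.id_apply, Kernel.const_apply,
      Measure.dirac_prod, Measure.map_map hΦ (by fun_prop)]
    rfl
  have hbd : ∀ q i, Φ q (bdryTime ha i) = q.1 i := fun q i => gluePath_bdryTime _ _ _ _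
  have hin : ∀ q j s, Φ q (innerTime ha j s) = Y j s q := fun q j s => gluePath_innerTime _ _ _ _ _
  have hmeas : ∀ t, Measurable fun q => Φ q t := fun t => (measurable_pi_apply t).comp hΦ
  have hfst : (fun (q : (Fin (K + 1) → Fin 2 → ℝ) × (∀ j, Ω j)) i => Φ q (bdryTime ha i)) =
      Prod.fst := by
    funext q i; exact hbd q i
  refine ⟨_, inferInstance, Q.prod ν, fun t q => Φ q t, inferInstance, hmeas, ?_, κ,
    Kernel.IsMarkovKernel.map _ hΦ, ?_, fun x => ⟨?_, fun j => ?_⟩⟩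
  · rw [hfst, ← Measure.fst, Measure.fst_prod]
  · refine ⟨?_, ?_⟩
    · rw [hfst]; exact (measurable_fst.prodMk hΦ).aemeasurable
    · rw [hfst, ← Measure.fst, Measure.fst_prod]
      ext s hs
      rw [Measure.map_apply (measurable_fst.prodMk hΦ) hs,
        Measure.prod_apply (measurable_fst.prodMk hΦ hs), Measure.compProd_apply hs]
      refine lintegral_congr fun x => ?_
      rw [hκ]
      exact (Measure.map_apply (hΦ.comp measurable_prodMk_left) (measurable_prodMk_left hs)).symm
  · rw [hκ]
    refine iIndepFun_map (hΦ.comp measurable_prodMk_left) (fun j => by fun_prop) ?_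
    simp only [hin]
    refine iIndepFun_pi (μ := P) (X := fun j ω s => X j s ω + meanVec (piece a j)
      (condMean (m j) (k j) (a j.castSucc) (a j.succ) (x j.castSucc) (x j.succ)) s) fun j => ?_
    exact (measurable_pi_iff.2 fun s => (hX j s).add_const _).aemeasurable
  · rw [hκ]
    refine (isDGP_map_iff (hΦ.comp measurable_prodMk_left) (fun t => by fun_prop)).2 ?_
    have e : (fun (t : Ioo (a j.castSucc) (a j.succ)) ω => Φ (x, ω) (innerTime ha j t)) =
        fun t ω => Y j t (x, ω) := by
      funext t ω; exact hin _ _ _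
    change IsDGP _ _ _ (fun t ω => Φ (x, ω) (innerTime ha j t)) ν
    rw [e]
    have h := hC j (m j) (hm j) (x j.castSucc) (x j.succ)
    rw [← (measurePreserving_eval P j).map_eq] at h
    exact (isDGP_map_iff (measurable_pi_apply j) fun t => (hX j t).add_const _).1 h

end Existence

/-! ### The string conditioned on its boundary values -/

section Conditioned

theorem covariance_congr_left {Ω : Type*} {mΩ : MeasurableSpace Ω} {P : Measure Ω}
    {X X' : Ω → ℝ} (h : X =ᵐ[P] X') (Y : Ω → ℝ) : cov[X, Y; P] = cov[X', Y; P] := by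
  rw [covariance, covariance, integral_congr_ae h]
  refine integral_congr_ae ?_
  filter_upwards [h] with ω hω
  rw [hω]

/-- A process all of whose values are almost surely affine functions of finitely many values of a
Gaussian process is Gaussian. -/
theorem IsGaussianProcess.of_ae_affine {Ω S T E F : Type*} {mΩ : MeasurableSpace Ω}
    {P : Measure Ω} [NormedAddCommGroup E] [NormedSpace ℝ E] [MeasurableSpace E] [BorelSpace E]
    [SecondCountableTopology E] [NormedAddCommGroup F] [NormedSpace ℝ F] [MeasurableSpace F]
    [BorelSpace F] [SecondCountableTopology F] {X : T → Ω → E} {Y : S → Ω → F}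
    (hX : IsGaussianProcess X P)
    (h : ∀ s, ∃ (d : F) (I : Finset T) (L : (I → E) →L[ℝ] F),
      ∀ᵐ ω ∂P, Y s ω = L (I.restrict (X · ω)) + d) : IsGaussianProcess Y P := by
  choose d I L hL using h
  exact (IsGaussianProcess.add_const (hX.of_isGaussianProcess
    (Y := fun s ω => L s ((I s).restrict (X · ω))) fun s => ⟨I s, L s, fun _ => rfl⟩) d).congr
    fun s => EventuallyEq.symm (hL s)

/-- Independent Gaussian processes form a Gaussian process. -/
theorem isGaussianProcess_sigma {Ω ι E : Type*} {T : ι → Type*} {mΩ : MeasurableSpace Ω}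
    {P : Measure Ω} [Fintype ι] [NormedAddCommGroup E] [NormedSpace ℝ E] [CompleteSpace E]
    [MeasurableSpace E] [BorelSpace E] [SecondCountableTopology E] {X : ∀ i, T i → Ω → E}
    (hX : ∀ i, IsGaussianProcess (X i) P) (hind : iIndepFun (fun i ω t => X i t ω) P) :
    IsGaussianProcess (fun p : Σ i, T i => X p.1 p.2) P := by
  classical
  refine ⟨fun I => ?_⟩
  let J : ∀ i, Finset (T i) := fun i =>
    I.preimage (Sigma.mk i) (sigma_mk_injective.injOn)
  have h1 : iIndepFun (fun i ω => (J i).restrict (X i · ω)) P :=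
    hind.comp (fun i f => (J i).restrict f) fun i => by fun_prop
  have h2 := h1.hasGaussianLaw fun i => (hX i).hasGaussianLaw (J i)
  let L : (∀ i, J i → E) →L[ℝ] (I → E) := ContinuousLinearMap.pi fun p =>
    (ContinuousLinearMap.proj (R := ℝ) (φ := fun _ : J p.1.1 => E)
      ⟨p.1.2, by simp [J]⟩).comp
        (ContinuousLinearMap.proj (R := ℝ) (φ := fun i => J i → E) p.1.1)
  exact h2.map L

variable {K : ℕ} {a : Fin (K + 1) → ℝ} {m : Fin K → ℝ → ℝ} {k : Fin K → ℝ → ℝ → ℝ}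
  {Ω : Type*} {mΩ : MeasurableSpace Ω}

/-- `D` is a string derivative Gaussian process conditioned to have boundary values `x`. -/
structure IsConditionedString (ha : StrictMono a) (m : Fin K → ℝ → ℝ) (k : Fin K → ℝ → ℝ → ℝ)
    (x : Fin (K + 1) → Fin 2 → ℝ) (D : Icc (a 0) (a (Fin.last K)) → Ω → Fin 2 → ℝ)
    (P : Measure Ω) : Prop where
  boundary : ∀ i, ∀ᵐ ω ∂P, D (bdryTime ha i) ω = x i
  indep : iIndepFun (fun (j : Fin K) ω (s : Ioo (a j.castSucc) (a j.succ)) =>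
    D (innerTime ha j s) ω) P
  cdgp : ∀ j : Fin K, IsCDGP (m j) (k j) (a j.castSucc) (a j.succ) (x j.castSucc) (x j.succ)
    (fun s => D (innerTime ha j s)) P

namespace IsConditionedString

variable {ha : StrictMono a} {x : Fin (K + 1) → Fin 2 → ℝ}
  {D : Icc (a 0) (a (Fin.last K)) → Ω → Fin 2 → ℝ} {P : Measure Ω}

/-- Inner values come from independent Gaussian processes and boundary values are almost surely
constant, so each value is an affine function of one Gaussian family. -/
theorem gaussian [NeZero K] (h : IsConditionedString ha m k x D P) :
    IsGaussianProcess D P := by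
  have := h.indep.isProbabilityMeasure
  refine IsGaussianProcess.of_ae_affine
    (isGaussianProcess_sigma (fun j => (h.cdgp j).gaussian) h.indep) fun t => ?_
  rcases eq_bdryTime_or_innerTime ha t with ⟨i, rfl⟩ | ⟨j, s, rfl⟩
  · refine ⟨x i, ∅, 0, ?_⟩
    filter_upwards [h.boundary i] with ω hω
    simpa using hω
  · exact ⟨0, {⟨j, s⟩}, ContinuousLinearMap.proj ⟨⟨j, s⟩, by simp⟩, by simp⟩

theorem memLp [NeZero K] (h : IsConditionedString ha m k x D P) (t : Icc (a 0) (a (Fin.last K)))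
    (i : Fin 2) : MemLp (fun ω => D t ω i) 2 P :=
  ((h.gaussian.hasGaussianLaw_eval t).map
    (ContinuousLinearMap.proj (R := ℝ) (φ := fun _ : Fin 2 => ℝ) i)).memLp_two

/-- The definition of the conditional process covers open pieces only. The formula persists at the
ends because `condMean` interpolates the boundary values and their slopes. -/
theorem integral_eq (h : IsConditionedString ha m k x D P)
    (hm : ∀ j, ContDiffOn ℝ 1 (m j) (piece a j))
    (hk : ∀ j, ContDiffOn ℝ 3 (fun p : ℝ × ℝ => k j p.1 p.2) (piece a j ×ˢ piece a j))
    (hJ : ∀ j, (jointBlock (piece a j) (k j) (a j.castSucc) (a j.succ)).det ≠ 0)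
    {j : Fin K} {t : Icc (a 0) (a (Fin.last K))} (ht : (t : ℝ) ∈ piece a j) (i : Fin 2) :
    ∫ ω, D t ω i ∂P = meanVec (piece a j)
      (condMean (m j) (k j) (a j.castSucc) (a j.succ) (x j.castSucc) (x j.succ)) t i := by
  have := h.indep.isProbabilityMeasure
  have hab : a j.castSucc < a j.succ := ha Fin.castSucc_lt_succ
  have hk2 : ContDiffOn ℝ 2 (fun p : ℝ × ℝ => k j p.1 p.2) _ := (hk j).of_le (by norm_num)
  have hb : ∀ i', ∫ ω, D (bdryTime ha i') ω i ∂P = x i' i := fun i' => by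
    have : (fun ω => D (bdryTime ha i') ω i) =ᵐ[P] fun _ => x i' i := by
      filter_upwards [h.boundary i'] with ω hω
      rw [hω]
    rw [integral_congr_ae this]
    simp
  rcases eq_bdryTime_or_innerTime_of_mem_piece ha ht with rfl | rfl | ⟨s, rfl⟩
  · rw [hb]
    exact congrFun (meanVec_condMean_left hab (hm j) hk2 (hJ j) _ _).symm i
  · rw [hb]
    exact congrFun (meanVec_condMean_right hab (hm j) hk2 (hJ j) _ _).symm i
  · exact ((h.cdgp j).mean_eq s i).trans (congrFun (meanVec_Ioo _ s.2) i)

theorem covariance_bdryTime_left (h : IsConditionedString ha m k x D P) (i : Fin (K + 1))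
    (l : Fin 2) (Y : Ω → ℝ) : cov[fun ω => D (bdryTime ha i) ω l, Y; P] = 0 := by
  have := h.indep.isProbabilityMeasure
  have : (fun ω => D (bdryTime ha i) ω l) =ᵐ[P] fun _ => x i l := by
    filter_upwards [h.boundary i] with ω hω
    rw [hω]
  rw [covariance_congr_left this, covariance_const_left]

/-- At an end point of the piece both sides vanish: the value is almost surely constant, and so the
covariance is zero, as is `condCov` with its derivatives. -/
theorem covariance_eq (h : IsConditionedString ha m k x D P)
    (hk : ∀ j, ContDiffOn ℝ 3 (fun p : ℝ × ℝ => k j p.1 p.2) (piece a j ×ˢ piece a j))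
    (hpos : ∀ j, IsKernelOn (piece a j) (k j))
    (hJ : ∀ j, (jointBlock (piece a j) (k j) (a j.castSucc) (a j.succ)).det ≠ 0)
    {j : Fin K} {s t : Icc (a 0) (a (Fin.last K))} (hs : (s : ℝ) ∈ piece a j)
    (ht : (t : ℝ) ∈ piece a j) (i l : Fin 2) :
    cov[fun ω => D s ω i, fun ω => D t ω l; P] =
      covBlock (piece a j) (condCov (k j) (a j.castSucc) (a j.succ)) s t i l := by
  have hab : a j.castSucc < a j.succ := ha Fin.castSucc_lt_succ
  have hleft : ∀ {s t : Icc (a 0) (a (Fin.last K))} (i l : Fin 2), (t : ℝ) ∈ piece a j →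
      s = bdryTime ha j.castSucc ∨ s = bdryTime ha j.succ →
      cov[fun ω => D s ω i, fun ω => D t ω l; P] =
        covBlock (piece a j) (condCov (k j) (a j.castSucc) (a j.succ)) s t i l := by
    intro s t i l ht hs
    rcases hs with rfl | rfl <;> rw [h.covariance_bdryTime_left]
    · exact congrFun (congrFun
        (covBlock_condCov_left hab (hk j) (hpos j) (hJ j) ht).symm i) l
    · exact congrFun (congrFun
        (covBlock_condCov_right hab (hk j) (hpos j) (hJ j) ht).symm i) l
  have hright : t = bdryTime ha j.castSucc ∨ t = bdryTime ha j.succ →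
      cov[fun ω => D s ω i, fun ω => D t ω l; P] =
        covBlock (piece a j) (condCov (k j) (a j.castSucc) (a j.succ)) s t i l := by
    intro h'
    rw [covariance_comm, hleft l i hs h',
      ← covBlock_condCov_transpose hab (hk j) (hpos j) (hJ j) hs ht, transpose_apply]
  rcases eq_bdryTime_or_innerTime_of_mem_piece ha hs with h1 | h1 | ⟨s, rfl⟩
  · exact hleft i l ht (Or.inl h1)
  · exact hleft i l ht (Or.inr h1)
  rcases eq_bdryTime_or_innerTime_of_mem_piece ha ht with h2 | h2 | ⟨t, rfl⟩
  · exact hright (Or.inl h2)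
  · exact hright (Or.inr h2)
  · exact ((h.cdgp j).cov_eq s t i l).trans
      (congrFun (congrFun (covBlock_Ioo _ s.2 t.2) i) l)

/-- Either one of the times is a boundary time, where the value is constant, or the two lie in
different open pieces and independence applies. -/
theorem covariance_eq_zero [NeZero K] (h : IsConditionedString ha m k x D P)
    {s t : Icc (a 0) (a (Fin.last K))}
    (hst : ¬ ∃ j, (s : ℝ) ∈ piece a j ∧ (t : ℝ) ∈ piece a j) (i l : Fin 2) :
    cov[fun ω => D s ω i, fun ω => D t ω l; P] = 0 := by
  rcases eq_bdryTime_or_innerTime ha s with ⟨i', rfl⟩ | ⟨j, s, rfl⟩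
  · exact h.covariance_bdryTime_left _ _ _
  rcases eq_bdryTime_or_innerTime ha t with ⟨i', rfl⟩ | ⟨j', t, rfl⟩
  · rw [covariance_comm]
    exact h.covariance_bdryTime_left _ _ _
  have hj : j ≠ j' := by
    rintro rfl
    exact hst ⟨j, Ioo_subset_Icc_self s.2, Ioo_subset_Icc_self t.2⟩
  refine IndepFun.covariance_eq_zero ?_ (h.memLp _ _) (h.memLp _ _)
  exact (h.indep.indepFun hj).comp (φ := fun f => f s i) (ψ := fun f => f t l)
    (by fun_prop) (by fun_prop)

end IsConditionedString

end Conditioned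

/-! ### Mixtures of laws with random mean and fixed variance -/

section Mixture

variable {𝓧 𝓨 : Type*} {m𝓧 : MeasurableSpace 𝓧} {m𝓨 : MeasurableSpace 𝓨}

/-- Under `κ x` the variable is distributed as `f x` plus noise whose law does not depend on `x`.
Averaging over `x` gives the sum of `f` and an independent noise. -/
theorem map_comp_eq_conv {Q : Measure 𝓧} [SFinite Q] {κ : Kernel 𝓧 𝓨} {Y : 𝓨 → ℝ}
    (hY : Measurable Y) {f : 𝓧 → ℝ} (hf : Measurable f) {v : NNReal}
    (h : ∀ᵐ x ∂Q, (κ x).map Y = gaussianReal (f x) v) :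
    (κ ∘ₘ Q).map Y = (Q.map f) ∗ gaussianReal 0 v := by
  ext s hs
  rw [Measure.map_apply hY hs, Measure.bind_apply (hY hs) κ.aemeasurable,
    ← lintegral_indicator_one hs, Measure.lintegral_conv (measurable_one.indicator hs),
    lintegral_map (by
      have := (measurable_one (α := ENNReal)).indicator hs
      exact Measurable.lintegral_prod_right' (this.comp measurable_add)) hf]
  refine lintegral_congr_ae ?_
  filter_upwards [h] with x hx
  rw [← Measure.map_apply hY hs, hx, ← zero_add (f x), ← gaussianReal_map_add_const,
    Measure.map_apply (by fun_prop) hs, ← lintegral_indicator_one (hs.preimage (by fun_prop))]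
  refine lintegral_congr fun y => ?_
  change s.indicator 1 (y + f x) = s.indicator 1 (0 + f x + y)
  rw [zero_add, add_comm]

/-- A mixture of Gaussian laws with a common covariance is Gaussian if the means have a Gaussian
law. -/
theorem isGaussian_map_comp {E : Type*} [NormedAddCommGroup E] [NormedSpace ℝ E]
    [MeasurableSpace E] [BorelSpace E] {Q : Measure E} [IsGaussian Q] {κ : Kernel E 𝓨}
    {Y : 𝓨 → ℝ} (hY : Measurable Y) (A : E →L[ℝ] ℝ) (d : ℝ) {v : NNReal}
    (h : ∀ᵐ x ∂Q, (κ x).map Y = gaussianReal (A x + d) v) : IsGaussian ((κ ∘ₘ Q).map Y) := by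
  rw [map_comp_eq_conv hY (A.continuous.measurable.add_const d) h]
  have : Q.map (fun x => A x + d) = (Q.map A).map (· + d) :=
    (Measure.map_map (g := (· + d)) (by fun_prop) A.continuous.measurable).symm
  rw [this]
  infer_instance

theorem lintegral_sq_eq {P : Measure 𝓨} [IsProbabilityMeasure P] {V : 𝓨 → ℝ} (hV : MemLp V 2 P) :
    ∫⁻ y, ‖V y‖ₑ ^ 2 ∂P = ENNReal.ofReal (Var[V; P] + (∫ y, V y ∂P) ^ 2) := by
  rw [variance_eq_sub hV, sub_add_cancel]
  simp only [Pi.pow_apply]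
  rw [ofReal_integral_eq_lintegral_ofReal hV.integrable_sq
    (Eventually.of_forall fun y => sq_nonneg _)]
  refine lintegral_congr fun y => ?_
  rw [Real.enorm_eq_ofReal_abs, ← ENNReal.ofReal_pow (abs_nonneg _), sq_abs]

/-- Mean square convergence under a mixture from convergence of conditional means and variances. -/
theorem tendsto_eLpNorm_comp {S C : Type*} [Fintype C] {l : Filter S} {Q : Measure 𝓧}
    [IsProbabilityMeasure Q] {κ : Kernel 𝓧 𝓨} [IsMarkovKernel κ] {V : S → 𝓨 → ℝ} {α v : S → ℝ}
    {β : S → C → ℝ} {ℓ : 𝓧 → C → ℝ} (hℓ : ∀ c, MemLp (fun x => ℓ x c) 2 Q)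
    (hV : ∀ s, Measurable (V s))
    (hcond : ∀ᶠ s in l, ∀ᵐ x ∂Q, MemLp (V s) 2 (κ x) ∧
      ∫ y, V s y ∂(κ x) = α s + ∑ c, β s c * ℓ x c ∧ Var[V s; κ x] = v s)
    (hα : Tendsto α l (𝓝 0)) (hβ : ∀ c, Tendsto (fun s => β s c) l (𝓝 0))
    (hv : Tendsto v l (𝓝 0)) :
    Tendsto (fun s => eLpNorm (V s) 2 (κ ∘ₘ Q)) l (𝓝 0) := by
  set E : ENNReal := ∫⁻ x, ENNReal.ofReal (∑ c, ℓ x c ^ 2) ∂Q with hE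
  have hEfin : E ≠ ⊤ := by
    have hint : Integrable (fun x => ∑ c, ℓ x c ^ 2) Q :=
      integrable_finsetSum _ fun c _ => (hℓ c).integrable_sq
    rw [hE, ← ofReal_integral_eq_lintegral_ofReal hint
      (Eventually.of_forall fun x => Finset.sum_nonneg fun c _ => sq_nonneg _)]
    exact ENNReal.ofReal_ne_top
  -- The conditional second moment is `v + (α + ∑ β ℓ)²`. Here `(p + q)² ≤ 2 p² + 2 q²` and
  -- Cauchy–Schwarz separate the deterministic coefficients from `∑ ℓ²`, whose mean `E` is finite.
  have hbound : ∀ᶠ s in l, ∫⁻ y, ‖V s y‖ₑ ^ 2 ∂(κ ∘ₘ Q) ≤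
      ENNReal.ofReal (v s + 2 * α s ^ 2) + ENNReal.ofReal (2 * ∑ c, β s c ^ 2) * E := by
    filter_upwards [hcond] with s hs
    rw [Measure.lintegral_bind κ.aemeasurable (by have := hV s; fun_prop),
      ← lintegral_const_mul' _ _ ENNReal.ofReal_ne_top]
    calc _ ≤ ∫⁻ x, (ENNReal.ofReal (v s + 2 * α s ^ 2) +
          ENNReal.ofReal (2 * ∑ c, β s c ^ 2) * ENNReal.ofReal (∑ c, ℓ x c ^ 2)) ∂Q := by
          refine lintegral_mono_ae ?_
          filter_upwards [hs] with x hx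
          rw [lintegral_sq_eq hx.1, hx.2.1, hx.2.2]
          have h0 : 0 ≤ v s := hx.2.2 ▸ variance_nonneg _ _
          have h1 : 0 ≤ 2 * ∑ c, β s c ^ 2 :=
            mul_nonneg zero_le_two (Finset.sum_nonneg fun c _ => sq_nonneg _)
          rw [← ENNReal.ofReal_mul h1, ← ENNReal.ofReal_add (by positivity)
            (mul_nonneg h1 (Finset.sum_nonneg fun c _ => sq_nonneg _))]
          refine ENNReal.ofReal_le_ofReal ?_
          have h2 := Finset.sum_mul_sq_le_sq_mul_sq Finset.univ (β s) (ℓ x)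
          nlinarith [sq_nonneg (α s - ∑ c, β s c * ℓ x c)]
      _ = _ := by
          rw [lintegral_add_left measurable_const]
          simp
  have hlim : Tendsto (fun s => ENNReal.ofReal (v s + 2 * α s ^ 2) +
      ENNReal.ofReal (2 * ∑ c, β s c ^ 2) * E) l (𝓝 0) := by
    have h1 : Tendsto (fun s => v s + 2 * α s ^ 2) l (𝓝 0) := by
      simpa using hv.add ((hα.pow 2).const_mul 2)
    have h2 : Tendsto (fun s => 2 * ∑ c, β s c ^ 2) l (𝓝 0) := by
      simpa using (tendsto_finsetSum Finset.univ fun c _ => (hβ c).pow 2).const_mul 2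
    have h3 := ENNReal.Tendsto.mul_const (ENNReal.tendsto_ofReal h2) (Or.inr hEfin)
    simpa using (ENNReal.tendsto_ofReal h1).add h3
  have hsq := tendsto_of_tendsto_of_tendsto_of_le_of_le' tendsto_const_nhds hlim
    (Eventually.of_forall fun s => zero_le) hbound
  have hrp := (ENNReal.continuous_rpow_const (y := 1 / 2)).tendsto 0 |>.comp hsq
  rw [ENNReal.zero_rpow_of_pos (by norm_num)] at hrp
  refine hrp.congr fun s => ?_
  rw [eLpNorm_eq_lintegral_rpow_enorm_toReal (by simp) (by simp)]
  simp

end Mixture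

/-! ### The string as a mixture over its boundary values -/

section Mixture

variable {K : ℕ} {a : Fin (K + 1) → ℝ} {m : Fin K → ℝ → ℝ} {k : Fin K → ℝ → ℝ → ℝ}

/-- The definition prescribes `κ x` on open pieces only. That paths take the values `x` at boundary
times follows, for almost every `x`, because the joint law of boundary values and path is carried by
the set where they are compatible. -/
theorem IsStringDGP.exists_kernel [NeZero K] {ha : StrictMono a} {Ω : Type*} [MeasurableSpace Ω]
    {SD : Icc (a 0) (a (Fin.last K)) → Ω → Fin 2 → ℝ} {P : Measure Ω} [IsProbabilityMeasure P]
    (h : IsStringDGP ha m k SD P) {Q : Measure (Fin (K + 1) → Fin 2 → ℝ)}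
    (hQ : Q = volume.withDensity fun x => ENNReal.ofReal (boundaryDensity a m k x)) :
    ∃ κ : Kernel (Fin (K + 1) → Fin 2 → ℝ) (Icc (a 0) (a (Fin.last K)) → Fin 2 → ℝ),
      IsMarkovKernel κ ∧ P.map (fun ω t => SD t ω) = κ ∘ₘ Q ∧
      ∀ᵐ x ∂Q, IsConditionedString ha m k x (fun t path => path t) (κ x) := by
  obtain ⟨κ, hκ, hlaw, hcond⟩ := h.conditional
  have hSD : Measurable fun ω t => SD t ω := measurable_pi_iff.2 h.measurable
  have hX : Measurable fun ω i => SD (bdryTime ha i) ω :=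
    measurable_pi_iff.2 fun i => h.measurable _
  have hPQ : P.map (fun ω i => SD (bdryTime ha i) ω) = Q := h.map_boundary.trans hQ.symm
  have hQp : IsProbabilityMeasure Q := hPQ ▸ Measure.isProbabilityMeasure_map hX.aemeasurable
  have hjoint : P.map (fun ω => ((fun i => SD (bdryTime ha i) ω), fun t => SD t ω)) = Q ⊗ₘ κ := by
    rw [← hPQ]; exact hlaw.map_eq
  refine ⟨κ, hκ, ?_, ?_⟩
  · rw [← Measure.snd_compProd, ← hjoint, Measure.snd_map_prodMk hX]
  · have hae : ∀ᵐ q ∂(Q ⊗ₘ κ), ∀ i, q.2 (bdryTime ha i) = q.1 i := by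
      have hm : MeasurableSet {q : (Fin (K + 1) → Fin 2 → ℝ) ×
          (Icc (a 0) (a (Fin.last K)) → Fin 2 → ℝ) | ∀ i, q.2 (bdryTime ha i) = q.1 i} := by
        rw [ofPred_forall]
        exact MeasurableSet.iInter fun i => measurableSet_eq_fun (by fun_prop) (by fun_prop)
      rw [← hjoint, ae_map_iff (hX.prodMk hSD).aemeasurable hm]
      exact Eventually.of_forall fun ω i => rfl
    filter_upwards [Measure.ae_ae_of_ae_compProd hae] with x hx
    exact ⟨fun i => by filter_upwards [hx] with p hp using hp i, (hcond x).1, (hcond x).2⟩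

theorem exists_affine_condCoef (a b : ℝ) (m : ℝ → ℝ) (k : ℝ → ℝ → ℝ) (i j : Fin (K + 1))
    (c : Fin 2 ⊕ Fin 2) : ∃ (A : (Fin (K + 1) → Fin 2 → ℝ) →L[ℝ] ℝ) (d : ℝ),
      ∀ x, condCoef m k a b (x i) (x j) c = A x + d := by
  refine ⟨LinearMap.toContinuousLinearMap
    { toFun := fun x => ((jointBlock (Icc a b) k a b)⁻¹ *ᵥ Sum.elim (x i) (x j)) c
      map_add' := fun x y => by
        rw [Pi.add_apply, Pi.add_apply, Sum.elim_add_add, mulVec_add, Pi.add_apply]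
      map_smul' := fun r x => ?_ },
    -((jointBlock (Icc a b) k a b)⁻¹ *ᵥ Sum.elim (meanVec (Icc a b) m a)
      (meanVec (Icc a b) m b)) c, fun x => ?_⟩
  · have : Sum.elim (r • x i) (r • x j) = r • Sum.elim (x i) (x j) := by
      ext (c | c) <;> rfl
    rw [Pi.smul_apply, Pi.smul_apply, this, mulVec_smul, Pi.smul_apply, RingHom.id_apply]
  · rw [condCoef, Sum.elim_sub_sub, mulVec_sub, Pi.sub_apply, sub_eq_add_neg]
    rfl

theorem exists_affine_meanVec {j : Fin K} (ha : StrictMono a)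
    (hm : ContDiffOn ℝ 1 (m j) (piece a j))
    (hk : ContDiffOn ℝ 3 (fun p : ℝ × ℝ => k j p.1 p.2) (piece a j ×ˢ piece a j)) {t : ℝ}
    (ht : t ∈ piece a j) (i : Fin 2) :
    ∃ (A : (Fin (K + 1) → Fin 2 → ℝ) →L[ℝ] ℝ) (d : ℝ), ∀ x, meanVec (piece a j)
      (condMean (m j) (k j) (a j.castSucc) (a j.succ) (x j.castSucc) (x j.succ)) t i =
        A x + d := by
  choose A d hA using exists_affine_condCoef (a j.castSucc) (a j.succ) (m j) (k j)
    j.castSucc j.succ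
  refine ⟨∑ c, crossMat (piece a j) (k j) (a j.castSucc) (a j.succ) t i c • A c,
    meanVec (piece a j) (m j) t i +
      ∑ c, crossMat (piece a j) (k j) (a j.castSucc) (a j.succ) t i c * d c, fun x => ?_⟩
  rw [meanVec_condMean (ha Fin.castSucc_lt_succ) hm (hk.of_le (by norm_num)) _ _ ht, Pi.add_apply,
    mulVec, dotProduct]
  simp only [hA, mul_add, Finset.sum_add_distrib, _root_.sum_apply,
    _root_.smul_apply, smul_eq_mul]
  ring

namespace IsConditionedString

variable {Ω : Type*} {mΩ : MeasurableSpace Ω}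
  {ha : StrictMono a} {x : Fin (K + 1) → Fin 2 → ℝ}
  {D : Icc (a 0) (a (Fin.last K)) → Ω → Fin 2 → ℝ} {P : Measure Ω}

theorem isGaussianProcess_coord [NeZero K] (h : IsConditionedString ha m k x D P) :
    IsGaussianProcess (fun (p : Icc (a 0) (a (Fin.last K)) × Fin 2) ω => D p.1 ω p.2) P :=
  ProbabilityTheory.IsGaussianProcess.of_isGaussianProcess h.gaussian fun p => ⟨{p.1},
    (ContinuousLinearMap.proj (R := ℝ) (φ := fun _ : Fin 2 => ℝ) p.2).comp
      (ContinuousLinearMap.proj ⟨p.1, by simp⟩), fun ω => rfl⟩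

theorem integral_sum [NeZero K] (h : IsConditionedString ha m k x D P) {ι : Type*} [Fintype ι]
    (w : ι → ℝ) (p : ι → Icc (a 0) (a (Fin.last K)) × Fin 2) :
    ∫ ω, ∑ i, w i * D (p i).1 ω (p i).2 ∂P = ∑ i, w i * ∫ ω, D (p i).1 ω (p i).2 ∂P := by
  have := h.indep.isProbabilityMeasure
  rw [integral_finsetSum _ fun i _ => ((h.memLp _ _).integrable one_le_two).const_mul _]
  exact Finset.sum_congr rfl fun _ _ => integral_const_mul _ _

theorem memLp_sum [NeZero K] (h : IsConditionedString ha m k x D P) {ι : Type*} [Fintype ι]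
    (w : ι → ℝ) (p : ι → Icc (a 0) (a (Fin.last K)) × Fin 2) :
    MemLp (fun ω => ∑ i, w i * D (p i).1 ω (p i).2) 2 P :=
  memLp_finsetSum _ fun _ _ => (h.memLp _ _).const_mul _

theorem variance_sum [NeZero K] (h : IsConditionedString ha m k x D P) {ι : Type*} [Fintype ι]
    (w : ι → ℝ) (p : ι → Icc (a 0) (a (Fin.last K)) × Fin 2) :
    Var[fun ω => ∑ i, w i * D (p i).1 ω (p i).2; P] = ∑ i, ∑ i', w i * w i' *
      cov[fun ω => D (p i).1 ω (p i).2, fun ω => D (p i').1 ω (p i').2; P] := by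
  have := h.indep.isProbabilityMeasure
  rw [← covariance_self (h.memLp_sum w p).aemeasurable,
    covariance_fun_sum_fun_sum (fun i => (h.memLp _ _).const_mul _)
      fun i => (h.memLp _ _).const_mul _]
  refine Finset.sum_congr rfl fun i _ => Finset.sum_congr rfl fun i' _ => ?_
  rw [covariance_const_mul_left, covariance_const_mul_right]
  ring

end IsConditionedString

/-- A mixture of conditioned strings over Gaussian boundary values is Gaussian. -/
theorem isGaussianProcess_mixture [NeZero K] {ha : StrictMono a}
    (hm : ∀ j, ContDiffOn ℝ 1 (m j) (piece a j))
    (hk : ∀ j, ContDiffOn ℝ 3 (fun p : ℝ × ℝ => k j p.1 p.2) (piece a j ×ˢ piece a j))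
    (hpos : ∀ j, IsKernelOn (piece a j) (k j))
    (hJ : ∀ j, (jointBlock (piece a j) (k j) (a j.castSucc) (a j.succ)).det ≠ 0)
    {Q : Measure (Fin (K + 1) → Fin 2 → ℝ)} [IsGaussian Q]
    {κ : Kernel (Fin (K + 1) → Fin 2 → ℝ) (Icc (a 0) (a (Fin.last K)) → Fin 2 → ℝ)}
    (hκ : ∀ᵐ x ∂Q, IsConditionedString ha m k x (fun t path => path t) (κ x)) :
    IsGaussianProcess (fun (p : Icc (a 0) (a (Fin.last K)) × Fin 2)
      (path : Icc (a 0) (a (Fin.last K)) → Fin 2 → ℝ) => path p.1 p.2) (κ ∘ₘ Q) := by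
  have hmean : ∀ p : Icc (a 0) (a (Fin.last K)) × Fin 2,
      ∃ (A : (Fin (K + 1) → Fin 2 → ℝ) →L[ℝ] ℝ) (d : ℝ), ∀ x,
        IsConditionedString ha m k x (fun t path => path t) (κ x) →
          ∫ path, path p.1 p.2 ∂(κ x) = A x + d := by
    intro p
    obtain ⟨j, hj⟩ := exists_mem_piece p.1.2
    obtain ⟨A, d, hA⟩ := exists_affine_meanVec ha (hm j) (hk j) hj p.2
    exact ⟨A, d, fun x hx => (hx.integral_eq hm hk hJ hj p.2).trans (hA x)⟩
  -- The order of quantifiers carries the argument: one covariance serves all boundary values, so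
  -- mixing affects only the means.
  have hcov : ∀ p q : Icc (a 0) (a (Fin.last K)) × Fin 2, ∃ r : ℝ, ∀ x,
        IsConditionedString ha m k x (fun t path => path t) (κ x) →
          cov[fun path => path p.1 p.2, fun path => path q.1 q.2; κ x] = r := by
    intro p q
    by_cases h : ∃ j, (p.1 : ℝ) ∈ piece a j ∧ (q.1 : ℝ) ∈ piece a j
    · obtain ⟨j, h1, h2⟩ := h
      exact ⟨_, fun x hx => hx.covariance_eq hk hpos hJ h1 h2 p.2 q.2⟩
    · exact ⟨0, fun x hx => hx.covariance_eq_zero h p.2 q.2⟩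
  choose A d hA using hmean
  choose R hR using hcov
  refine isGaussianProcess_of_forall_sum (fun _ => Measurable.aemeasurable (by fun_prop))
    fun I c => ?_
  refine isGaussian_map_comp (by fun_prop) (∑ p : I, c p • A p) (∑ p : I, c p * d p)
    (v := (∑ p : I, ∑ q : I, c p * c q * R p q).toNNReal) ?_
  filter_upwards [hκ] with x hx
  have hsum : (fun path : Icc (a 0) (a (Fin.last K)) → Fin 2 → ℝ =>
      ∑ p ∈ I, c p * path p.1 p.2) =
      fun path => ∑ p : I, c p * path (p : Icc (a 0) (a (Fin.last K)) × Fin 2).1 p.1.2 := by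
    funext path
    exact (Finset.sum_coe_sort I fun p => c p * path p.1 p.2).symm
  have hg : HasGaussianLaw (fun path : Icc (a 0) (a (Fin.last K)) → Fin 2 → ℝ =>
      ∑ p ∈ I, c p * path p.1 p.2) (κ x) :=
    (hx.isGaussianProcess_coord.smul c).hasGaussianLaw_fun_sum
  rw [hg.map_eq_gaussianReal, hsum, hx.integral_sum (fun p : I => c p) (fun p => p.1),
    hx.variance_sum (fun p : I => c p) (fun p => p.1)]
  simp only [hA _ x hx, hR _ _ x hx, mul_add, Finset.sum_add_distrib,
    _root_.sum_apply, _root_.smul_apply, smul_eq_mul]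

/-- Within one closed piece, a combination of values has conditional mean linear in `condCoef`, with
coefficients given by `crossMat`, and a conditional variance free of `x`. As `condCoef` is affine in
a Gaussian vector it is square integrable, and three deterministic limits suffice. -/
theorem tendsto_eLpNorm_mixture [NeZero K] {ha : StrictMono a}
    (hm : ∀ j, ContDiffOn ℝ 1 (m j) (piece a j))
    (hk : ∀ j, ContDiffOn ℝ 3 (fun p : ℝ × ℝ => k j p.1 p.2) (piece a j ×ˢ piece a j))
    (hpos : ∀ j, IsKernelOn (piece a j) (k j))
    (hJ : ∀ j, (jointBlock (piece a j) (k j) (a j.castSucc) (a j.succ)).det ≠ 0)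
    {Q : Measure (Fin (K + 1) → Fin 2 → ℝ)} [IsGaussian Q]
    {κ : Kernel (Fin (K + 1) → Fin 2 → ℝ) (Icc (a 0) (a (Fin.last K)) → Fin 2 → ℝ)}
    [IsMarkovKernel κ]
    (hκ : ∀ᵐ x ∂Q, IsConditionedString ha m k x (fun t path => path t) (κ x)) (j : Fin K)
    {S ι : Type*} [Fintype ι] {l : Filter S} {w : S → ι → ℝ}
    {p : S → ι → Icc (a 0) (a (Fin.last K)) × Fin 2}
    (hp : ∀ᶠ s in l, ∀ i, ((p s i).1 : ℝ) ∈ piece a j)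
    (hα : Tendsto (fun s => ∑ i, w s i * meanVec (piece a j) (m j) (p s i).1 (p s i).2) l (𝓝 0))
    (hβ : ∀ c, Tendsto (fun s => ∑ i, w s i *
      crossMat (piece a j) (k j) (a j.castSucc) (a j.succ) (p s i).1 (p s i).2 c) l (𝓝 0))
    (hv : Tendsto (fun s => ∑ i, ∑ i', w s i * w s i' *
      covBlock (piece a j) (condCov (k j) (a j.castSucc) (a j.succ)) (p s i).1 (p s i').1
        (p s i).2 (p s i').2) l (𝓝 0)) :
    Tendsto (fun s => eLpNorm (fun path : Icc (a 0) (a (Fin.last K)) → Fin 2 → ℝ =>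
      ∑ i, w s i * path (p s i).1 (p s i).2) 2 (κ ∘ₘ Q)) l (𝓝 0) := by
  refine tendsto_eLpNorm_comp (ℓ := fun x =>
    condCoef (m j) (k j) (a j.castSucc) (a j.succ) (x j.castSucc) (x j.succ))
    (fun c => ?_) (fun s => by fun_prop) ?_ hα hβ hv
  · obtain ⟨A, d, hA⟩ := exists_affine_condCoef (a j.castSucc) (a j.succ) (m j) (k j)
      j.castSucc j.succ c
    simp only [hA]
    exact (IsGaussian.memLp_dual Q A 2 (by simp)).add (memLp_const d)
  · filter_upwards [hp] with s hs
    filter_upwards [hκ] with x hx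
    refine ⟨hx.memLp_sum (w s) (p s), ?_, ?_⟩
    · rw [hx.integral_sum (w s) (p s)]
      simp only [hx.integral_eq hm hk hJ (hs _), meanVec_condMean (ha Fin.castSucc_lt_succ) (hm j)
        ((hk j).of_le (by norm_num)) _ _ (hs _), Pi.add_apply, mulVec, dotProduct, mul_add,
        Finset.sum_add_distrib, Finset.mul_sum, Finset.sum_mul, mul_assoc]
      rw [Finset.sum_comm]
    · rw [hx.variance_sum (w s) (p s)]
      simp only [hx.covariance_eq hk hpos hJ (hs _) (hs _)]

end Mixture

/-! ### Mean square differentiability and continuity of the derivative -/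

section MeanSquare

/-- Differentiability in the shape needed for the weights `(u - t)⁻¹`, `-(u - t)⁻¹`, `-1` on `z_u`,
`z_t`, `z'_t`. -/
theorem HasDerivWithinAt.tendsto_sum {f : ℝ → ℝ} {f' t : ℝ} {I : Set ℝ}
    (h : HasDerivWithinAt f f' I t) :
    Tendsto (fun u => (u - t)⁻¹ * f u + -(u - t)⁻¹ * f t + -1 * f') (𝓝[I \ {t}] t) (𝓝 0) := by
  have h1 := (hasDerivWithinAt_iff_tendsto_div.1 h).sub_const f'
  rw [sub_self] at h1
  exact h1.congr fun u => by ring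

variable {I : Set ℝ} {R : ℝ → ℝ → ℝ}

/-- The variance of `(z_u - z_t) / (u - t) - z'_t` tends to `0`. -/
theorem tendsto_variance_slope (hI : UniqueDiffOn ℝ I) (hc : Convex ℝ I)
    (hR : ContDiffOn ℝ 2 (fun p : ℝ × ℝ => R p.1 p.2) (I ×ˢ I))
    (hsymm : ∀ x ∈ I, ∀ y ∈ I, R x y = R y x) {t : ℝ} (ht : t ∈ I) :
    Tendsto (fun u => ∑ i, ∑ j, ![(u - t)⁻¹, -(u - t)⁻¹, -1] i * ![(u - t)⁻¹, -(u - t)⁻¹, -1] j *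
      covBlock I R (![u, t, t] i) (![u, t, t] j) ((![0, 0, 1] : Fin 3 → Fin 2) i)
        ((![0, 0, 1] : Fin 3 → Fin 2) j)) (𝓝[I \ {t}] t) (𝓝 0) := by
  have hself : Tendsto (fun u : ℝ => u) (𝓝[I \ {t}] t) (𝓝[I \ {t}] t) := tendsto_id
  -- The variance is a second difference quotient, minus twice a difference quotient of `∂R/∂y`,
  -- plus the mixed derivative at `(t, t)`. All three involve the same limit `A`, and `A - 2 A + A =
  -- 0`.
  have h1 := tendsto_second_difference hI hc hR ht ht hself hself
  have h2 := hasDerivWithinAt_iff_tendsto_div.1 (hasDerivWithinAt_partialXY hI hR ht ht)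
  have h3 := (h1.sub (h2.const_mul 2)).add_const (partialXY I R t t)
  have h0 : partialXY I R t t - 2 * partialXY I R t t + partialXY I R t t = 0 := by ring
  rw [h0] at h3
  refine h3.congr' ?_
  filter_upwards [self_mem_nhdsWithin] with u hu
  have hne : u - t ≠ 0 := sub_ne_zero.2 hu.2
  simp only [Fin.sum_univ_three, covBlock, of_apply, cons_val', cons_val_zero, cons_val_one,
    cons_val_fin_one, cons_val, partialX_eq_partialY hsymm ht hu.1,
    partialX_eq_partialY hsymm ht ht, hsymm t ht u hu.1]
  field_simp
  ring

theorem tendsto_variance_sub (hI : UniqueDiffOn ℝ I)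
    (hR : ContDiffOn ℝ 2 (fun p : ℝ × ℝ => R p.1 p.2) (I ×ˢ I)) {t : ℝ} (ht : t ∈ I) :
    Tendsto (fun u => ∑ i, ∑ j, (![1, -1] : Fin 2 → ℝ) i * (![1, -1] : Fin 2 → ℝ) j *
      covBlock I R (![u, t] i) (![u, t] j) 1 1) (𝓝[I] t) (𝓝 0) := by
  have hc := continuousOn_partialXY hI hR (t, t) ⟨ht, ht⟩
  have hself : Tendsto (fun u : ℝ => u) (𝓝[I] t) (𝓝[I] t) := tendsto_id
  have hconst : Tendsto (fun _ : ℝ => t) (𝓝[I] t) (𝓝[I] t) :=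
    tendsto_nhdsWithin_iff.2 ⟨tendsto_const_nhds, Eventually.of_forall fun _ => ht⟩
  have hp : ∀ {f g : ℝ → ℝ}, Tendsto f (𝓝[I] t) (𝓝[I] t) → Tendsto g (𝓝[I] t) (𝓝[I] t) →
      Tendsto (fun u => partialXY I R (f u) (g u)) (𝓝[I] t) (𝓝 (partialXY I R t t)) := by
    intro f g hf hg
    refine hc.tendsto.comp (f := fun u => (f u, g u)) ?_
    rw [nhdsWithin_prod_eq]
    exact hf.prodMk hg
  have h := (((hp hself hself).sub (hp hself hconst)).sub (hp hconst hself)).add (hp hconst hconst)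
  rw [show partialXY I R t t - partialXY I R t t - partialXY I R t t + partialXY I R t t = 0 by
    ring] at h
  refine h.congr fun u => ?_
  simp only [Fin.sum_univ_two, covBlock, of_apply, cons_val', cons_val_zero, cons_val_one,
    cons_val_fin_one]
  ring

theorem tendsto_of_forall_inf_principal {α β ι : Type*} [Finite ι] {f : α → β} {l : Filter α}
    {l' : Filter β} {s : ι → Set α} (hs : ∀ x, ∃ i, x ∈ s i)
    (h : ∀ i, Tendsto f (l ⊓ 𝓟 (s i)) l') : Tendsto f l l' := by
  intro U hU
  have h1 : ∀ i, ∀ᶠ x in l, x ∈ s i → f x ∈ U := fun i => eventually_inf_principal.1 (h i hU)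
  have h2 : ∀ᶠ x in l, ∀ i, x ∈ s i → f x ∈ U := eventually_all.2 h1
  refine mem_map.2 (h2.mono fun x hx => ?_)
  obtain ⟨i, hi⟩ := hs x
  exact hx i hi

variable {K : ℕ} {a : Fin (K + 1) → ℝ} {m : Fin K → ℝ → ℝ} {k : Fin K → ℝ → ℝ → ℝ}

/-- To prove convergence at a point of `[a_0, a_K]` it suffices to do so along the closed pieces
containing it. -/
theorem tendsto_of_forall_piece [NeZero K] {β : Type*} {f : Icc (a 0) (a (Fin.last K)) → β}
    {t : Icc (a 0) (a (Fin.last K))} {s : Set (Icc (a 0) (a (Fin.last K)))} {l' : Filter β}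
    (h : ∀ j, (t : ℝ) ∈ piece a j → Tendsto f (𝓝[s] t ⊓ 𝓟 {u | (u : ℝ) ∈ piece a j}) l') :
    Tendsto f (𝓝[s] t) l' := by
  refine tendsto_of_forall_inf_principal (s := fun j => {u | (u : ℝ) ∈ piece a j})
    (fun u => exists_mem_piece u.2) fun j => ?_
  by_cases ht : (t : ℝ) ∈ piece a j
  · exact h j ht
  -- A closed piece that misses `t` misses a neighbourhood of `t`, so the filter along it is
  -- trivial.
  · have hcl : IsClosed {u : Icc (a 0) (a (Fin.last K)) | (u : ℝ) ∈ piece a j} :=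
      isClosed_Icc.preimage continuous_subtype_val
    have : 𝓝[s] t ⊓ 𝓟 {u | (u : ℝ) ∈ piece a j} = ⊥ :=
      inf_principal_eq_bot.2 (nhdsWithin_le_nhds (hcl.isOpen_compl.mem_nhds ht))
    rw [this]
    exact tendsto_bot

theorem tendsto_val_piece {t : Icc (a 0) (a (Fin.last K))} {j : Fin K} :
    Tendsto (fun u : Icc (a 0) (a (Fin.last K)) => (u : ℝ))
      (𝓝 t ⊓ 𝓟 {u | (u : ℝ) ∈ piece a j}) (𝓝[piece a j] t) :=
  tendsto_nhdsWithin_iff.2 ⟨(continuous_subtype_val.tendsto t).mono_left inf_le_left,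
    eventually_inf_principal.2 (Eventually.of_forall fun _ hu => hu)⟩

theorem tendsto_val_piece_ne {t : Icc (a 0) (a (Fin.last K))} {j : Fin K} :
    Tendsto (fun u : Icc (a 0) (a (Fin.last K)) => (u : ℝ))
      (𝓝[≠] t ⊓ 𝓟 {u | (u : ℝ) ∈ piece a j}) (𝓝[piece a j \ {(t : ℝ)}] t) := by
  refine tendsto_nhdsWithin_iff.2 ⟨(continuous_subtype_val.tendsto t).mono_left
    (inf_le_left.trans nhdsWithin_le_nhds), eventually_inf_principal.2 ?_⟩
  filter_upwards [self_mem_nhdsWithin] with u hu hu'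
  exact ⟨hu', fun h => hu (Subtype.ext h)⟩

/-- A junction belongs to two closed pieces. The limit along each of them is computed with the data
of that piece, and both limits are expressed through the same value `path t 1`. -/
theorem hasL2Deriv_and_l2Continuous [NeZero K] {ha : StrictMono a}
    (hm : ∀ j, ContDiffOn ℝ 1 (m j) (piece a j))
    (hk : ∀ j, ContDiffOn ℝ 3 (fun p : ℝ × ℝ => k j p.1 p.2) (piece a j ×ˢ piece a j))
    (hpos : ∀ j, IsKernelOn (piece a j) (k j))
    (hJ : ∀ j, (jointBlock (piece a j) (k j) (a j.castSucc) (a j.succ)).det ≠ 0)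
    {Q : Measure (Fin (K + 1) → Fin 2 → ℝ)} [IsGaussian Q]
    {κ : Kernel (Fin (K + 1) → Fin 2 → ℝ) (Icc (a 0) (a (Fin.last K)) → Fin 2 → ℝ)}
    [IsMarkovKernel κ]
    (hκ : ∀ᵐ x ∂Q, IsConditionedString ha m k x (fun t path => path t) (κ x)) :
    (∀ t : Icc (a 0) (a (Fin.last K)), Tendsto (fun s : Icc (a 0) (a (Fin.last K)) => eLpNorm
      (fun path : Icc (a 0) (a (Fin.last K)) → Fin 2 → ℝ =>
        (path s 0 - path t 0) / ((s : ℝ) - (t : ℝ)) - path t 1) 2 (κ ∘ₘ Q)) (𝓝[≠] t) (𝓝 0)) ∧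
    ∀ t : Icc (a 0) (a (Fin.last K)), Tendsto (fun s : Icc (a 0) (a (Fin.last K)) => eLpNorm
      (fun path : Icc (a 0) (a (Fin.last K)) → Fin 2 → ℝ => path s 1 - path t 1) 2 (κ ∘ₘ Q))
        (𝓝 t) (𝓝 0) := by
  have hab : ∀ j : Fin K, a j.castSucc < a j.succ := fun j => ha Fin.castSucc_lt_succ
  have hU : ∀ j : Fin K, UniqueDiffOn ℝ (piece a j) := fun j => uniqueDiffOn_Icc (hab j)
  have hk2 : ∀ j, ContDiffOn ℝ 2 (fun p : ℝ × ℝ => k j p.1 p.2) (piece a j ×ˢ piece a j) :=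
    fun j => (hk j).of_le (by norm_num)
  have hC2 := fun j => contDiffOn_condCov (hab j) (hk j)
  have hsymm := fun j => condCov_symm (hab j) (hk j) (hpos j) (hJ j)
  refine ⟨fun t => tendsto_of_forall_piece fun j ht => ?_, fun t => ?_⟩
  · have hval := tendsto_val_piece_ne (t := t) (j := j)
    have H := tendsto_eLpNorm_mixture hm hk hpos hJ hκ j
      (l := 𝓝[≠] t ⊓ 𝓟 {u | (u : ℝ) ∈ piece a j})
      (w := fun u => ![((u : ℝ) - t)⁻¹, -((u : ℝ) - t)⁻¹, -1])
      (p := fun u => ![(u, 0), (t, 0), (t, 1)]) ?_ ?_ ?_ ?_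
    · refine H.congr fun u => ?_
      congr 1
      funext path
      simp only [Fin.sum_univ_three, cons_val_zero, cons_val_one, cons_val]
      ring
    · refine eventually_inf_principal.2 (Eventually.of_forall fun u hu i => ?_)
      fin_cases i
      exacts [hu, ht, ht]
    · have h := ((hm j).differentiableOn (by simp) t ht).hasDerivWithinAt
      refine ((HasDerivWithinAt.tendsto_sum h).comp hval).congr fun u => ?_
      simp [Fin.sum_univ_three, meanVec]
    · intro c
      have h := hasDerivWithinAt_crossRow (hab j) (hk2 j) ht c
      refine ((HasDerivWithinAt.tendsto_sum h).comp hval).congr fun u => ?_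
      simp [Fin.sum_univ_three, crossMat_zero]
    · refine ((tendsto_variance_slope (hU j) (convex_Icc _ _) (hC2 j) (hsymm j) ht).comp
        hval).congr fun u => ?_
      refine Finset.sum_congr rfl fun i _ => Finset.sum_congr rfl fun i' _ => ?_
      fin_cases i <;> fin_cases i' <;> rfl
  · rw [← nhdsWithin_univ]
    refine tendsto_of_forall_piece fun j ht => ?_
    rw [nhdsWithin_univ]
    have hval := tendsto_val_piece (t := t) (j := j)
    have hsub : ∀ {f : ℝ → ℝ}, ContinuousOn f (piece a j) →
        Tendsto (fun u : Icc (a 0) (a (Fin.last K)) => f u - f t)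
          (𝓝 t ⊓ 𝓟 {u | (u : ℝ) ∈ piece a j}) (𝓝 0) := by
      intro f hf
      have := ((hf t ht).tendsto.sub_const (f t)).comp hval
      rwa [sub_self] at this
    have H := tendsto_eLpNorm_mixture hm hk hpos hJ hκ j
      (l := 𝓝 t ⊓ 𝓟 {u | (u : ℝ) ∈ piece a j})
      (w := fun _ => ![1, -1]) (p := fun u => ![(u, 1), (t, 1)]) ?_ ?_ ?_ ?_
    · refine H.congr fun u => ?_
      congr 1
      funext path
      simp only [Fin.sum_univ_two, cons_val_zero, cons_val_one, cons_val_fin_one]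
      ring
    · refine eventually_inf_principal.2 (Eventually.of_forall fun u hu i => ?_)
      fin_cases i
      exacts [hu, ht]
    · refine (hsub ((hm j).continuousOn_derivWithin (hU j) le_rfl)).congr fun u => ?_
      simp [Fin.sum_univ_two, meanVec, sub_eq_add_neg]
    · intro c
      have hd : ContinuousOn
          (fun u => crossMat (piece a j) (k j) (a j.castSucc) (a j.succ) u 1 c) (piece a j) :=
        ((contDiffOn_crossRow (hab j) (hk j) c).continuousOn_derivWithin (hU j)
          (by norm_num)).congr fun u hu =>
            ((hasDerivWithinAt_crossRow (hab j) (hk2 j) hu c).derivWithin (hU j u hu)).symm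
      refine (hsub hd).congr fun u => ?_
      simp [Fin.sum_univ_two, sub_eq_add_neg]
    · refine ((tendsto_variance_sub (hU j) (hC2 j) ht).comp hval).congr fun u => ?_
      refine Finset.sum_congr rfl fun i _ => Finset.sum_congr rfl fun i' _ => ?_
      fin_cases i <;> fin_cases i' <;> rfl

end MeanSquare

end StringGP

end

/-! ### Existence and regularity of string processes -/

theorem theorem1 {K : ℕ} [NeZero K] (a : Fin (K + 1) → ℝ) (ha : StrictMono a)
    (m : Fin K → ℝ → ℝ) (k : Fin K → ℝ → ℝ → ℝ)
    (hm : ∀ j, ContDiffOn ℝ 1 (m j) (StringGP.piece a j))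
    (hk : ∀ j, ContDiffOn ℝ 3 (fun p : ℝ × ℝ => k j p.1 p.2)
      (StringGP.piece a j ×ˢ StringGP.piece a j))
    (hpos : ∀ j, StringGP.IsKernelOn (StringGP.piece a j) (k j))
    (hdeg : ∀ j, ¬ StringGP.DegenerateAt (StringGP.piece a j) (k j) (a j.castSucc))
    (hdeg' : ∀ j, ¬ StringGP.DegenerateAtGiven (StringGP.piece a j) (k j)
      (a j.succ) (a j.castSucc)) :
    (∃ (Ω : Type) (_ : MeasurableSpace Ω) (P : Measure Ω)
        (SD : Icc (a 0) (a (Fin.last K)) → Ω → Fin 2 → ℝ),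
      IsProbabilityMeasure P ∧ StringGP.IsStringDGP ha m k SD P) ∧
    (∀ (Ω : Type*) [MeasurableSpace Ω] (P : Measure Ω) [IsProbabilityMeasure P]
        (SD : Icc (a 0) (a (Fin.last K)) → Ω → Fin 2 → ℝ),
      StringGP.IsStringDGP ha m k SD P →
        IsGaussianProcess (fun t ω => SD t ω 0) P ∧
        StringGP.IsL2C1 (fun t ω => SD t ω 0) P ∧
        StringGP.HasL2Deriv (fun t ω => SD t ω 0) (fun t ω => SD t ω 1) P) := by
  have hJ := fun j => StringGP.jointBlock_det_ne_zero (hdeg j) (hdeg' j)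
  refine ⟨StringGP.exists_isStringDGP ha hm hk hpos hJ, fun Ω _ P _ SD hSD => ?_⟩
  have hQ := StringGP.isGaussian_boundary ha m hk hpos hJ
  obtain ⟨κ, _, hmap, hκ⟩ := hSD.exists_kernel rfl
  have hmeas : Measurable fun ω t => SD t ω := measurable_pi_iff.2 hSD.measurable
  have hG := StringGP.isGaussianProcess_mixture hm hk hpos hJ hκ
  -- The results on path space concern only the law of the path, so they pull back along `ω ↦ (SD t
  -- ω)_t`.
  rw [← hmap, StringGP.isGaussianProcess_map_iff hmeas (fun _ => by fun_prop)] at hG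
  obtain ⟨hd, hc⟩ := StringGP.hasL2Deriv_and_l2Continuous hm hk hpos hJ hκ
  have hmem : ∀ t i, MemLp (fun ω => SD t ω i) 2 P := fun t i =>
    (hG.hasGaussianLaw_eval (t, i)).memLp_two
  have hderiv : StringGP.HasL2Deriv (fun t ω => SD t ω 0) (fun t ω => SD t ω 1) P := by
    refine ⟨fun t => hmem t 0, fun t => hmem t 1, fun t => (hd t).congr fun s => ?_⟩
    rw [← hmap, eLpNorm_map_measure (by fun_prop) hmeas.aemeasurable]
    rfl
  refine ⟨hG.comp_right fun t => (t, 0), ⟨_, hderiv, fun t => (hc t).congr fun s => ?_⟩, hderiv⟩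
  rw [← hmap, eLpNorm_map_measure (by fun_prop) hmeas.aemeasurable]
  rfl
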